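/- Let $(\zeta_j)_{j\in\mathbb Z}$ be i.i.d. positive random variables with finite mean $\mu$ (their variance may be infinite). Define the environment $\omega=(\omega_k)_{k\in\mathbb Z}$ by $\omega_0=0$ and $\omega_k=\omega_{k-1}+\zeta_k$ for all $k\in\mathbb Z$, and let $P$ be its law. Let $(\xi_i)_{i\ge 1}$ be i.i.d. $\mathbb Z$-valued random variables with density $(p_k)_{k\in\mathbb Z}$ and joint law $Q$, where $p_{-k}=p_k$ for all $k$, $p_{k+1}\le p_k$ for all $k\ge 1$ (no condition is imposed on $p_0$, so the simple symmetric random walk is included), and $0<\sum_k k^2p_k<\infty$. Put $S_0=0$, $S_n=\xi_1+\dots+\xi_n$, $Y_n=\omega_{S_n}$, $\tau(0)=0$ and $\tau(n)=\sum_{k=1}^n|\omega_{S_k}-\omega_{S_{k-1}}|$, and define the continuous-time process $$X(t)=Y_n+\operatorname{sgn}(\xi_{n+1})\,(t-\tau(n))\qquad\text{for } t\in[\tau(n),\tau(n+1)).$$ For fixed $\omega$, let $P_\omega$ be the law of the path $(X(t))_{t\ge0}$ under $Q$ (the quenched law). Let $\mathbb P(G\times F)=\int_F P_\omega(G)\,P(d\omega)$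 be the annealed law on pairs (path, environment), with expectation $\mathbb E$. Set $$\bar m=\sum_{k\in\mathbb Z}|k|\,p_k,\qquad m_2=\lim_{n\to\infty}\frac{E_Q(|S_n|^2)}{n}.$$ Then the limit defining $m_2$ exists, and $$\liminf_{t\to\infty}\frac{\mathbb E\left(X(t)^2\right)}{t}\ \ge\ \frac{\mu}{\bar m}\,m_2 .$$ -/

import Mathlib

open MeasureTheory ProbabilityTheory Filter Topology
open scoped ENNReal NNReal

noncomputable section

namespace LevyEnv

/-! ### The environment -/

/-- The targets `ω = (ω_k)` built from the gaps `ζ = (ζ_k)`: `ω_0 = 0` and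
`ω_k = ω_{k-1} + ζ_k` for every integer `k` (see `targets_zero` and `targets_rec`). -/
def targets (ζ : ℤ → ℝ) (k : ℤ) : ℝ :=
  ∑ j ∈ Finset.Ioc 0 k, ζ j - ∑ j ∈ Finset.Ioc k 0, ζ j

theorem targets_zero (ζ : ℤ → ℝ) : targets ζ 0 = 0 := by simp [targets]

theorem targets_rec (ζ : ℤ → ℝ) (k : ℤ) : targets ζ k = targets ζ (k - 1) + ζ k := by
  unfold targets
  rcases lt_or_ge 0 k with hk | hk
  · have h1 : Finset.Ioc 0 k = insert k (Finset.Ioc 0 (k - 1)) := by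
      ext x; simp only [Finset.mem_Ioc, Finset.mem_insert]; omega
    have h2 : Finset.Ioc k 0 = ∅ := Finset.Ioc_eq_empty (by omega)
    have h3 : Finset.Ioc (k - 1) 0 = ∅ := Finset.Ioc_eq_empty (by omega)
    rw [h1, h2, h3, Finset.sum_insert (by simp)]
    simp [add_comm]
  · have h1 : Finset.Ioc (k - 1) 0 = insert k (Finset.Ioc k 0) := by
      ext x; simp only [Finset.mem_Ioc, Finset.mem_insert]; omega
    have h2 : Finset.Ioc 0 k = ∅ := Finset.Ioc_eq_empty (by omega)
    have h3 : Finset.Ioc 0 (k - 1) = ∅ := Finset.Ioc_eq_empty (by omega)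
    rw [h1, h2, h3, Finset.sum_insert (by simp)]
    simp

/-- The law `P` of the environment `ω`, when the gaps are i.i.d. with law `ν`. -/
def envLaw (ν : Measure ℝ) [IsProbabilityMeasure ν] : Measure (ℤ → ℝ) :=
  (Measure.infinitePi (fun _ : ℤ => ν)).map targets

/-! ### The underlying random walk -/

/-- The law `Q` of the i.i.d. jumps with density `p`; `ξ i` is the jump number `i + 1`. -/
def walkLaw (p : PMF ℤ) : Measure (ℕ → ℤ) :=
  Measure.infinitePi (fun _ : ℕ => p.toMeasure)

instance (p : PMF ℤ) : IsProbabilityMeasure (walkLaw p) := by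
  unfold walkLaw; infer_instance

/-- The underlying walk `S_n`, the sum of the first `n` jumps. -/
def walk (ξ : ℕ → ℤ) (n : ℕ) : ℤ := ∑ i ∈ Finset.range n, ξ i

/-- The mean absolute jump `∑_k |k| p_k`. -/
def meanAbsJump (p : PMF ℤ) : ℝ := ∑' k : ℤ, |(k : ℝ)| * (p k).toReal

/-- `E_Q(|S_n|^q) / n^(q/2)`. -/
def scaledMoment (p : PMF ℤ) (q : ℝ) (n : ℕ) : ℝ≥0∞ :=
  (∫⁻ ξ, ENNReal.ofReal (|(walk ξ n : ℝ)| ^ q) ∂(walkLaw p)) / (n : ℝ≥0∞) ^ (q / 2)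

/-- `m_q`, the limit of `E_Q(|S_n|^q) / n^(q/2)` as `n → ∞`. -/
def limitMoment (p : PMF ℤ) (q : ℝ) : ℝ≥0∞ := limUnder atTop (scaledMoment p q)

/-! ### The continuous-time process -/

/-- The collision time `τ(n) = ∑_{k=1}^n |ω_{S_k} - ω_{S_{k-1}}|`. -/
def collisionTime (ω : ℤ → ℝ) (ξ : ℕ → ℤ) (n : ℕ) : ℝ :=
  ∑ k ∈ Finset.range n, |ω (walk ξ (k + 1)) - ω (walk ξ k)|

/-- The number of collisions `n(t) = max {m | τ(m) ≤ t}` up to time `t`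
(`0` on the null event where there is no maximum). -/
def collisionNumber (ω : ℤ → ℝ) (ξ : ℕ → ℤ) (t : ℝ≥0) : ℕ :=
  sSup {m : ℕ | collisionTime ω ξ m ≤ t}

/-- The position `X(t)`: it equals `Y_n + sgn(ξ_{n+1}) (t - τ(n))`, with `Y_n = ω_{S_n}`, for
`t ∈ [τ(n), τ(n+1))` (see `position_eq`). -/
def position (ω : ℤ → ℝ) (ξ : ℕ → ℤ) (t : ℝ≥0) : ℝ :=
  ω (walk ξ (collisionNumber ω ξ t)) +
    ((ξ (collisionNumber ω ξ t)).sign : ℝ) *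
      ((t : ℝ) - collisionTime ω ξ (collisionNumber ω ξ t))

theorem collisionTime_mono (ω : ℤ → ℝ) (ξ : ℕ → ℤ) : Monotone (collisionTime ω ξ) :=
  monotone_nat_of_le_succ fun n => by
    rw [collisionTime, collisionTime, Finset.sum_range_succ]
    exact le_add_of_nonneg_right (abs_nonneg _)

theorem position_eq (ω : ℤ → ℝ) (ξ : ℕ → ℤ) (t : ℝ≥0) (n : ℕ)
    (h₁ : collisionTime ω ξ n ≤ t) (h₂ : (t : ℝ) < collisionTime ω ξ (n + 1)) :
    position ω ξ t = ω (walk ξ n) + ((ξ n).sign : ℝ) * ((t : ℝ) - collisionTime ω ξ n) := by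
  have hs : {m : ℕ | collisionTime ω ξ m ≤ t} = Set.Iic n := by
    ext m
    simp only [Set.mem_ofPred_eq, Set.mem_Iic]
    refine ⟨fun hm => ?_, fun hm => (collisionTime_mono ω ξ hm).trans h₁⟩
    by_contra hlt
    have := collisionTime_mono ω ξ (show n + 1 ≤ m by omega)
    linarith
  have hn : collisionNumber ω ξ t = n := by
    unfold collisionNumber; rw [hs]; exact csSup_Iic
  simp only [position, hn]

/-! ### Measurability, needed for the quenched law to be a kernel -/

theorem measurable_walk (n : ℕ) : Measurable fun ξ : ℕ → ℤ => walk ξ n := by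
  unfold walk; fun_prop

theorem measurable_eval {α : Type*} [MeasurableSpace α] {w : α → ℤ → ℝ} {k : α → ℤ}
    (hw : Measurable w) (hk : Measurable k) : Measurable fun a => w a (k a) :=
  measurable_from_prod_countable_left (f := fun x : (α × ℤ) => w x.1 x.2)
    (fun j => (measurable_pi_apply j).comp hw) |>.comp (measurable_id.prodMk hk)

theorem measurable_collisionTime (n : ℕ) :
    Measurable fun x : (ℤ → ℝ) × (ℕ → ℤ) => collisionTime x.1 x.2 n := by
  unfold collisionTime
  refine Finset.measurable_sum _ fun k _ => ?_
  have h : ∀ m : ℕ, Measurable fun x : (ℤ → ℝ) × (ℕ → ℤ) => x.1 (walk x.2 m) := fun m =>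
    measurable_eval measurable_fst ((measurable_walk m).comp measurable_snd)
  exact continuous_abs.measurable.comp ((h (k + 1)).sub (h k))

theorem measurable_collisionNumber (t : ℝ≥0) :
    Measurable fun x : (ℤ → ℝ) × (ℕ → ℤ) => collisionNumber x.1 x.2 t := by
  have hm : ∀ m : ℕ, MeasurableSet {x : (ℤ → ℝ) × (ℕ → ℤ) | collisionTime x.1 x.2 m ≤ t} :=
    fun m => measurableSet_le (measurable_collisionTime m) measurable_const
  have hb : ∀ k : ℕ, MeasurableSet
      {x : (ℤ → ℝ) × (ℕ → ℤ) | ∀ m : ℕ, collisionTime x.1 x.2 m ≤ t → m ≤ k} := fun k => by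
    simp only [Set.ofPred_forall]
    refine MeasurableSet.iInter fun m => ?_
    by_cases hmk : m ≤ k
    · simp [hmk]
    · have he : {x : (ℤ → ℝ) × (ℕ → ℤ) | collisionTime x.1 x.2 m ≤ t → m ≤ k} =
          {x | collisionTime x.1 x.2 m ≤ t}ᶜ := by
        ext x; simp [hmk]
      rw [he]
      exact (hm m).compl
  refine measurable_of_Iic fun k => ?_
  have he : (fun x : (ℤ → ℝ) × (ℕ → ℤ) => collisionNumber x.1 x.2 t) ⁻¹' Set.Iic k =
      {x | ∀ m : ℕ, collisionTime x.1 x.2 m ≤ t → m ≤ k} ∪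
      (⋃ N : ℕ, {x | ∀ m : ℕ, collisionTime x.1 x.2 m ≤ t → m ≤ N})ᶜ := by
    ext x
    simp only [Set.mem_preimage, Set.mem_Iic, Set.mem_union, Set.mem_ofPred_eq, Set.mem_compl_iff,
      Set.mem_iUnion, collisionNumber]
    by_cases hB : ∃ N : ℕ, ∀ m : ℕ, collisionTime x.1 x.2 m ≤ t → m ≤ N
    · obtain ⟨N, hN⟩ := hB
      have hbd : BddAbove {m : ℕ | collisionTime x.1 x.2 m ≤ t} := ⟨N, fun m h => hN m h⟩
      refine ⟨fun h => Or.inl fun m h' => (le_csSup hbd h').trans h, ?_⟩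
      rintro (h | h)
      · exact csSup_le' fun m h' => h m h'
      · exact absurd ⟨N, hN⟩ h
    · refine ⟨fun _ => Or.inr hB, fun _ => ?_⟩
      have hbd : ¬ BddAbove {m : ℕ | collisionTime x.1 x.2 m ≤ t} :=
        fun ⟨N, hN⟩ => hB ⟨N, fun m h => hN h⟩
      rw [csSup_of_not_bddAbove hbd]
      simp
  rw [he]
  exact (hb k).union (MeasurableSet.iUnion hb).compl

theorem measurable_position :
    Measurable fun x : (ℤ → ℝ) × (ℕ → ℤ) => position x.1 x.2 := by
  refine measurable_pi_lambda _ fun t => ?_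
  have hN := measurable_collisionNumber t
  have hcomp : ∀ {β : Type} [MeasurableSpace β] (f : (ℤ → ℝ) × (ℕ → ℤ) → ℕ → β),
      (∀ n, Measurable fun x => f x n) →
      Measurable fun x => f x (collisionNumber x.1 x.2 t) := fun f hf =>
    measurable_from_prod_countable_left
      (f := fun y : ((ℤ → ℝ) × (ℕ → ℤ)) × ℕ => f y.1 y.2) hf |>.comp (measurable_id.prodMk hN)
  unfold position
  refine (measurable_eval measurable_fst (hcomp (fun x n => walk x.2 n) fun n =>
    (measurable_walk n).comp measurable_snd)).add (Measurable.mul ?_ ?_)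
  · exact hcomp (fun x n => ((x.2 n).sign : ℝ)) fun n =>
      (measurable_of_countable (fun k : ℤ => (k.sign : ℝ))).comp
        ((measurable_pi_apply n).comp measurable_snd)
  · exact measurable_const.sub
      (hcomp (fun x n => collisionTime x.1 x.2 n) measurable_collisionTime)

/-! ### Quenched and annealed laws -/

/-- The quenched law `P_ω`: the law of the path `t ↦ X(t)` in the environment `ω`, on the space of
paths with the σ-algebra generated by the cylinders, as a kernel in `ω`. -/
def quenchedLaw (p : PMF ℤ) : Kernel (ℤ → ℝ) (ℝ≥0 → ℝ) where
  toFun ω := (walkLaw p).map (position ω)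
  measurable' := by
    refine Measure.measurable_of_measurable_coe _ fun G hG => ?_
    have h : ∀ ω : ℤ → ℝ, (walkLaw p).map (position ω) G = walkLaw p
        (Prod.mk ω ⁻¹' ((fun x : (ℤ → ℝ) × (ℕ → ℤ) => position x.1 x.2) ⁻¹' G)) := fun ω => by
      have hω : Measurable (position ω) :=
        measurable_position.comp (measurable_prodMk_left (x := ω))
      rw [Measure.map_apply hω hG]
      rfl
    simp only [h]
    exact measurable_measure_prodMk_left (measurable_position hG)

instance (p : PMF ℤ) : IsMarkovKernel (quenchedLaw p) :=
  ⟨fun ω => Measure.isProbabilityMeasure_map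
    (measurable_position.comp (measurable_prodMk_left (x := ω))).aemeasurable⟩

/-- The annealed law on paths times environments, characterised by
`ℙ(G × F) = ∫_F P_ω(G) P(dω)` (see `annealedLaw_prod`). -/
def annealedLaw (ν : Measure ℝ) [IsProbabilityMeasure ν] (p : PMF ℤ) :
    Measure ((ℝ≥0 → ℝ) × (ℤ → ℝ)) :=
  ((envLaw ν) ⊗ₘ (quenchedLaw p)).map Prod.swap

theorem measurable_targets : Measurable targets := by
  refine measurable_pi_lambda _ fun k => ?_
  unfold targets
  fun_prop

instance (ν : Measure ℝ) [IsProbabilityMeasure ν] : IsProbabilityMeasure (envLaw ν) :=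
  Measure.isProbabilityMeasure_map measurable_targets.aemeasurable

theorem annealedLaw_prod (ν : Measure ℝ) [IsProbabilityMeasure ν] (p : PMF ℤ)
    {G : Set (ℝ≥0 → ℝ)} {F : Set (ℤ → ℝ)} (hG : MeasurableSet G) (hF : MeasurableSet F) :
    annealedLaw ν p (G ×ˢ F) = ∫⁻ ω in F, quenchedLaw p ω G ∂(envLaw ν) := by
  rw [annealedLaw, Measure.map_apply measurable_swap (hG.prod hF), Set.preimage_swap_prod,
    Measure.compProd_apply_prod hF hG]

end LevyEnv

end

namespace LevyEnv

/-! ### Sums of independent centred random variables -/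

section CentredSums

variable {Ω : Type*} [MeasurableSpace Ω] {P : Measure Ω}
  {X : ℕ → Ω → ℝ} {v : ℝ}

theorem memLp_sum_range (hL : ∀ i, MemLp (X i) 2 P) (n : ℕ) :
    MemLp (fun ω => ∑ i ∈ Finset.range n, X i ω) 2 P :=
  memLp_finsetSum _ fun i _ => hL i

theorem integral_sum_range_eq_zero [IsProbabilityMeasure P] (hL : ∀ i, MemLp (X i) 2 P)
    (h0 : ∀ i, ∫ ω, X i ω ∂P = 0) (n : ℕ) : ∫ ω, ∑ i ∈ Finset.range n, X i ω ∂P = 0 := by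
  rw [integral_finsetSum _ fun i _ => (hL i).integrable (by norm_num)]
  simp [h0]

theorem integral_sq_sum_range [IsProbabilityMeasure P] (hi : iIndepFun X P) (hL : ∀ i, MemLp (X i) 2 P)
    (h0 : ∀ i, ∫ ω, X i ω ∂P = 0) (hv : ∀ i, ∫ ω, X i ω ^ 2 ∂P = v) (n : ℕ) :
    ∫ ω, (∑ i ∈ Finset.range n, X i ω) ^ 2 ∂P = n * v := by
  have h := IndepFun.variance_sum (X := X) (s := Finset.range n) (fun i _ => hL i)
    fun i _ j _ hij => hi.indepFun hij
  have e : (∑ i ∈ Finset.range n, X i) = fun ω => ∑ i ∈ Finset.range n, X i ω := by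
    ext ω; simp
  rw [e, variance_of_integral_eq_zero (memLp_sum_range hL n).aemeasurable
    (integral_sum_range_eq_zero hL h0 n)] at h
  rw [h, Finset.sum_congr rfl fun i _ => ?_, Finset.sum_const, Finset.card_range, nsmul_eq_mul]
  rw [variance_of_integral_eq_zero (hL i).aemeasurable (h0 i), hv i]

theorem indepFun_sum_range (hi : iIndepFun X P) (hm : ∀ i, Measurable (X i)) (n : ℕ) :
    IndepFun (fun ω => ∑ i ∈ Finset.range n, X i ω) (X n) P := by
  have h := hi.indepFun_finsetSum_of_notMem hm (s := Finset.range n) (i := n) (by simp)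
  have e : (∑ i ∈ Finset.range n, X i) = fun ω => ∑ i ∈ Finset.range n, X i ω := by
    ext ω; simp
  rwa [e] at h

/-- The squared partial sums, indexed so that the sum up to `n` is adapted to the natural
filtration. -/
theorem submartingale_sq_sum [IsProbabilityMeasure P] (hi : iIndepFun X P)
    (hm : ∀ i, Measurable (X i)) (hL : ∀ i, MemLp (X i) 2 P) (h0 : ∀ i, ∫ ω, X i ω ∂P = 0) :
    Submartingale (fun n ω => (∑ i ∈ Finset.range (n + 1), X i ω) ^ 2)
      (Filtration.natural X fun i => (hm i).stronglyMeasurable) P := by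
  have hsm : ∀ n, StronglyMeasurable[Filtration.natural X (fun i => (hm i).stronglyMeasurable) n]
      (fun ω => ∑ i ∈ Finset.range (n + 1), X i ω) := fun n => by
    refine Finset.stronglyMeasurable_fun_sum _ fun i hi => ?_
    exact ((Filtration.stronglyAdapted_natural (u := X)
      (fun i => (hm i).stronglyMeasurable)) i).mono
      ((Filtration.natural X _).mono (by simpa using Nat.lt_succ_iff.mp (Finset.mem_range.mp hi)))
  refine submartingale_of_setIntegral_le_succ (fun n => (hsm n).pow 2)
    (fun n => (memLp_sum_range hL (n + 1)).integrable_sq) fun n s hs => ?_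
  have hs' : MeasurableSet s := (Filtration.natural X _).le n _ hs
  have hind := hi.indep_comap_natural_of_lt (fun i => (hm i).stronglyMeasurable)
    (Nat.lt_succ_self n)
  have hI : IndepFun (s.indicator fun ω => ∑ i ∈ Finset.range (n + 1), X i ω) (X (n + 1)) P := by
    rw [IndepFun_iff_Indep]
    exact indep_of_indep_of_le_left hind.symm ((hsm n).indicator hs).measurable.comap_le
  have hz : ∫ ω in s, (∑ i ∈ Finset.range (n + 1), X i ω) * X (n + 1) ω ∂P = 0 := by
    rw [← integral_indicator hs']
    have h := hI.integral_mul_eq_mul_integral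
      ((memLp_sum_range hL (n + 1)).aestronglyMeasurable.indicator hs')
      (hL (n + 1)).aestronglyMeasurable
    rw [h0, mul_zero] at h
    rw [← h]
    congr 1
    ext ω
    by_cases hω : ω ∈ s <;> simp [hω]
  have hi1 := (memLp_sum_range hL (n + 1)).integrable_sq
  have hi2 := (memLp_sum_range hL (n + 1)).integrable_mul (hL (n + 1))
  have hi3 := (hL (n + 1)).integrable_sq
  have e : ∀ ω, (∑ i ∈ Finset.range (n + 1 + 1), X i ω) ^ 2 =
      (∑ i ∈ Finset.range (n + 1), X i ω) ^ 2 +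
        (2 * ((∑ i ∈ Finset.range (n + 1), X i ω) * X (n + 1) ω) + X (n + 1) ω ^ 2) := fun ω => by
    rw [Finset.sum_range_succ _ (n + 1)]; ring
  simp only [e]
  have hi2' : Integrable (fun ω => 2 * ((∑ i ∈ Finset.range (n + 1), X i ω) * X (n + 1) ω)) P :=
    hi2.const_mul 2
  rw [integral_add hi1.integrableOn (hi2'.fun_add hi3).integrableOn,
    integral_add hi2'.integrableOn hi3.integrableOn, integral_const_mul, hz]
  have : 0 ≤ ∫ ω in s, X (n + 1) ω ^ 2 ∂P := integral_nonneg fun ω => sq_nonneg _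
  linarith

/-- **Kolmogorov's maximal inequality**. -/
theorem measure_exists_le_abs_sum [IsProbabilityMeasure P] (hi : iIndepFun X P)
    (hm : ∀ i, Measurable (X i)) (hL : ∀ i, MemLp (X i) 2 P) (h0 : ∀ i, ∫ ω, X i ω ∂P = 0)
    (hv : ∀ i, ∫ ω, X i ω ^ 2 ∂P = v) (n : ℕ) {r : ℝ} (hr : 0 < r) :
    P {ω | ∃ k ≤ n, r ≤ |∑ i ∈ Finset.range k, X i ω|} ≤ ENNReal.ofReal (n * v / r ^ 2) := by
  rcases n with _ | n
  · have : {ω | ∃ k ≤ 0, r ≤ |∑ i ∈ Finset.range k, X i ω|} = ∅ := by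
      ext ω; simp only [Nat.le_zero, exists_eq_left, Set.mem_ofPred_eq]; simpa using hr
    rw [this]; simp
  have h := maximal_ineq (submartingale_sq_sum hi hm hL h0) (fun n ω => sq_nonneg _)
    (ε := (r ^ 2).toNNReal) n
  have hr2 : 0 < r ^ 2 := by positivity
  have hsub : {ω | ∃ k ≤ n + 1, r ≤ |∑ i ∈ Finset.range k, X i ω|} ⊆
      {ω | ((r ^ 2).toNNReal : ℝ) ≤ (Finset.range (n + 1)).sup' Finset.nonempty_range_add_one
        fun k => (∑ i ∈ Finset.range (k + 1), X i ω) ^ 2} := by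
    rintro ω ⟨k, hk, hle⟩
    rcases k with _ | k
    · simp at hle; linarith
    · simp only [Set.mem_ofPred_eq, Real.coe_toNNReal _ hr2.le]
      refine le_trans ?_ (Finset.le_sup' _ (Finset.mem_range.mpr (show k < n + 1 by omega)))
      rw [← sq_abs (∑ i ∈ _, _)]
      exact pow_le_pow_left₀ hr.le hle 2
  have hint : ∀ s : Set Ω, ∫ ω in s, (∑ i ∈ Finset.range (n + 1), X i ω) ^ 2 ∂P ≤
      ((n + 1 : ℕ) : ℝ) * v := fun s => by
    rw [← integral_sq_sum_range hi hL h0 hv (n + 1)]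
    exact setIntegral_le_integral (memLp_sum_range hL (n + 1)).integrable_sq
      (Eventually.of_forall fun ω => sq_nonneg _)
  have h2 := h.trans (ENNReal.ofReal_le_ofReal (hint _))
  rw [ENNReal.ofReal_div_of_pos hr2, ENNReal.le_div_iff_mul_le
    (Or.inl (by simpa using hr2.ne')) (Or.inl ENNReal.ofReal_ne_top), mul_comm]
  exact le_trans (mul_le_mul_right (measure_mono hsub) _) h2

theorem integral_pow_four_sum_range_le [IsProbabilityMeasure P] {K : ℝ} (hi : iIndepFun X P)
    (hm : ∀ i, Measurable (X i)) (hK : ∀ i ω, |X i ω| ≤ K) (h0 : ∀ i, ∫ ω, X i ω ∂P = 0) (n : ℕ) :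
    ∫ ω, (∑ i ∈ Finset.range n, X i ω) ^ 4 ∂P ≤ 3 * K ^ 4 * n ^ 2 := by
  have hb : ∀ (f : Ω → ℝ), Measurable f → ∀ C : ℝ, (∀ ω, |f ω| ≤ C) → Integrable f P :=
    fun f hf C hC => Integrable.of_bound hf.aestronglyMeasurable C (Eventually.of_forall hC)
  have hL : ∀ i, MemLp (X i) 2 P := fun i =>
    MemLp.of_bound (hm i).aestronglyMeasurable K (Eventually.of_forall (hK i))
  have hK0 : ∀ i ω, X i ω ^ 2 ≤ K ^ 2 := fun i ω => by
    rw [← sq_abs]; exact pow_le_pow_left₀ (abs_nonneg _) (hK i ω) 2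
  have hSm : ∀ n, Measurable fun ω => ∑ i ∈ Finset.range n, X i ω := fun n => by fun_prop
  have hSb : ∀ n ω, |∑ i ∈ Finset.range n, X i ω| ≤ n * K := fun n ω =>
    (Finset.abs_sum_le_sum_abs _ _).trans
      ((Finset.sum_le_sum fun i _ => hK i ω).trans (by simp))
  have hmom : ∀ n a b, Integrable (fun ω => (∑ i ∈ Finset.range n, X i ω) ^ a * X n ω ^ b) P :=
    fun n a b => hb _ (by fun_prop) ((n * K) ^ a * K ^ b) fun ω => by
      rw [abs_mul, abs_pow, abs_pow]
      have hK' : 0 ≤ K := (abs_nonneg _).trans (hK 0 ω)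
      gcongr
      · exact hSb n ω
      · exact hK n ω
  have hprod : ∀ n a b, ∫ ω, (∑ i ∈ Finset.range n, X i ω) ^ a * X n ω ^ b ∂P =
      (∫ ω, (∑ i ∈ Finset.range n, X i ω) ^ a ∂P) * ∫ ω, X n ω ^ b ∂P := fun n a b =>
    ((indepFun_sum_range hi hm n).comp (measurable_id.pow_const a)
      (measurable_id.pow_const b)).integral_mul_eq_mul_integral
      ((hSm n).pow_const a).aestronglyMeasurable ((hm n).pow_const b).aestronglyMeasurable
  have hX2 : ∀ n, ∫ ω, X n ω ^ 2 ∂P ≤ K ^ 2 := fun n => by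
    calc ∫ ω, X n ω ^ 2 ∂P ≤ ∫ ω, K ^ 2 ∂P :=
          integral_mono (hL n).integrable_sq (integrable_const _) (hK0 n)
      _ = K ^ 2 := by simp
  have hX4 : ∀ n, ∫ ω, X n ω ^ 4 ∂P ≤ K ^ 4 := fun n => by
    calc ∫ ω, X n ω ^ 4 ∂P ≤ ∫ ω, K ^ 4 ∂P :=
          integral_mono (by simpa using hmom n 0 4) (integrable_const _) fun ω => by
            have := pow_le_pow_left₀ (sq_nonneg _) (hK0 n ω) 2
            simpa only [← pow_mul] using this
      _ = K ^ 4 := by simp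
  have hS2 : ∀ n : ℕ, ∫ ω, (∑ i ∈ Finset.range n, X i ω) ^ 2 ∂P ≤ n * K ^ 2 := fun n => by
    induction n with
    | zero => simp
    | succ n ih =>
      have e : ∀ ω, (∑ i ∈ Finset.range (n + 1), X i ω) ^ 2 =
          (∑ i ∈ Finset.range n, X i ω) ^ 2 * X n ω ^ 0 +
          (2 * ((∑ i ∈ Finset.range n, X i ω) ^ 1 * X n ω ^ 1) +
            (∑ i ∈ Finset.range n, X i ω) ^ 0 * X n ω ^ 2) := fun ω => by
        rw [Finset.sum_range_succ]; ring
      simp only [e]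
      rw [integral_add (hmom n 2 0) (((hmom n 1 1).const_mul 2).fun_add (hmom n 0 2)),
        integral_add ((hmom n 1 1).const_mul 2) (hmom n 0 2), integral_const_mul,
        hprod, hprod, hprod]
      simp only [pow_one, h0, pow_zero, integral_const, probReal_univ, smul_eq_mul, mul_one,
        mul_zero, one_mul, zero_add]
      push_cast
      linarith [hX2 n]
  induction n with
  | zero => simp
  | succ n ih =>
    have e : ∀ ω, (∑ i ∈ Finset.range (n + 1), X i ω) ^ 4 =
        (∑ i ∈ Finset.range n, X i ω) ^ 4 * X n ω ^ 0 +
        (4 * ((∑ i ∈ Finset.range n, X i ω) ^ 3 * X n ω ^ 1) +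
        (6 * ((∑ i ∈ Finset.range n, X i ω) ^ 2 * X n ω ^ 2) +
        (4 * ((∑ i ∈ Finset.range n, X i ω) ^ 1 * X n ω ^ 3) +
          (∑ i ∈ Finset.range n, X i ω) ^ 0 * X n ω ^ 4))) := fun ω => by
      rw [Finset.sum_range_succ]; ring
    simp only [e]
    have i4 := hmom n 0 4
    have i3 := ((hmom n 1 3).const_mul 4).fun_add i4
    have i2 := ((hmom n 2 2).const_mul 6).fun_add i3
    have i1 := ((hmom n 3 1).const_mul 4).fun_add i2
    rw [integral_add (hmom n 4 0) i1, integral_add ((hmom n 3 1).const_mul 4) i2,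
      integral_add ((hmom n 2 2).const_mul 6) i3, integral_add ((hmom n 1 3).const_mul 4) i4,
      integral_const_mul, integral_const_mul, integral_const_mul,
      hprod, hprod, hprod, hprod, hprod]
    simp only [pow_one, h0, integral_sum_range_eq_zero hL h0, pow_zero, integral_const,
      probReal_univ, smul_eq_mul, mul_one, mul_zero, one_mul, zero_add, zero_mul]
    have h22 : (∫ ω, (∑ i ∈ Finset.range n, X i ω) ^ 2 ∂P) * ∫ ω, X n ω ^ 2 ∂P ≤
        (n * K ^ 2) * K ^ 2 :=
      mul_le_mul (hS2 n) (hX2 n) (integral_nonneg fun ω => sq_nonneg _) (by positivity)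
    have h4 := hX4 n
    have hK4 : 0 ≤ K ^ 4 := by positivity
    push_cast
    nlinarith

end CentredSums

/-- The identity cut off outside `(-K, K]`. -/
noncomputable def cutoff (K : ℝ) : ℝ → ℝ := (Set.Ioc (-K) K).indicator id

theorem measurable_cutoff (K : ℝ) : Measurable (cutoff K) :=
  measurable_id.indicator measurableSet_Ioc

theorem abs_cutoff_le {K : ℝ} (hK : 0 ≤ K) (x : ℝ) : |cutoff K x| ≤ K := by
  by_cases h : x ∈ Set.Ioc (-K) K
  · rw [cutoff, Set.indicator_of_mem h]
    exact abs_le.mpr ⟨h.1.le, h.2⟩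
  · rw [cutoff, Set.indicator_of_notMem h]
    simpa using hK

theorem abs_sub_cutoff_le (K x : ℝ) : |x - cutoff K x| ≤ |x| := by
  by_cases h : x ∈ Set.Ioc (-K) K
  · rw [cutoff, Set.indicator_of_mem h]; simp
  · rw [cutoff, Set.indicator_of_notMem h]; simp

theorem tendsto_cutoff (x : ℝ) : Tendsto (fun K : ℝ => x - cutoff K x) atTop (𝓝 0) := by
  refine tendsto_const_nhds.congr' ?_
  filter_upwards [eventually_gt_atTop |x|] with K hK
  have h : x ∈ Set.Ioc (-K) K := ⟨(abs_lt.mp hK).1, (abs_lt.mp hK).2.le⟩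
  rw [cutoff, Set.indicator_of_mem h]; simp

/-- The error made by cutting off tends to `0` in `L^q`. -/
theorem tendsto_integral_abs_sub_cutoff_pow {Ω : Type*} [MeasurableSpace Ω] {P : Measure Ω}
    {X : Ω → ℝ} (hX : AEStronglyMeasurable X P) {q : ℕ} (hq : q ≠ 0)
    (hi : Integrable (fun ω => |X ω| ^ q) P) :
    Tendsto (fun K : ℝ => ∫ ω, |X ω - cutoff K (X ω)| ^ q ∂P) atTop (𝓝 0) := by
  have h := tendsto_integral_filter_of_dominated_convergence (μ := P) (l := atTop)
    (F := fun K ω => |X ω - cutoff K (X ω)| ^ q) (f := fun _ => 0) (fun ω => |X ω| ^ q) ?_ ?_ hi ?_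
  · simpa using h
  · refine Eventually.of_forall fun K => ?_
    have := ((measurable_cutoff K).comp_aemeasurable hX.aemeasurable).aestronglyMeasurable
    exact ((hX.sub this).norm.pow q)
  · refine Eventually.of_forall fun K => Eventually.of_forall fun ω => ?_
    rw [Real.norm_of_nonneg (by positivity)]
    exact pow_le_pow_left₀ (abs_nonneg _) (abs_sub_cutoff_le K _) q
  · refine Eventually.of_forall fun ω => ?_
    have := ((tendsto_cutoff (X ω)).abs.pow q)
    simpa [hq] using this

/-- The normalised squares of the partial sums of i.i.d. centred square integrable random
variables are uniformly integrable. -/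
theorem exists_forall_setIntegral_sq_sum_le {Ω : Type*} [MeasurableSpace Ω] {P : Measure Ω}
    [IsProbabilityMeasure P] {X : ℕ → Ω → ℝ} (hi : iIndepFun X P) (hm : ∀ i, Measurable (X i))
    (hid : ∀ i, IdentDistrib (X i) (X 0) P P) (hL : MemLp (X 0) 2 P)
    (h0 : ∫ ω, X 0 ω ∂P = 0) {ε : ℝ} (hε : 0 < ε) :
    ∃ δ > 0, ∀ (n : ℕ) (A : Set Ω), MeasurableSet A → P.real A ≤ δ →
      ∫ ω in A, (∑ i ∈ Finset.range n, X i ω) ^ 2 ∂P ≤ ε * n := by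
  obtain ⟨K, hK, hK0⟩ : ∃ K : ℝ, ∫ ω, |X 0 ω - cutoff K (X 0 ω)| ^ 2 ∂P < ε / 8 ∧ 0 < K :=
    (((tendsto_integral_abs_sub_cutoff_pow hL.aestronglyMeasurable two_ne_zero
      (by simpa using hL.integrable_sq)).eventually_lt_const (by positivity)).and
        (eventually_gt_atTop 0)).exists
  simp only [sq_abs] at hK
  set c : ℝ := ∫ ω, cutoff K (X 0 ω) ∂P with hc
  have hcK : |c| ≤ K := by
    have := norm_integral_le_of_norm_le_const (μ := P) (f := fun ω => cutoff K (X 0 ω)) (C := K)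
      (Eventually.of_forall fun ω => abs_cutoff_le hK0.le _)
    simpa using this
  have hfm : Measurable fun x => cutoff K x - c := (measurable_cutoff K).sub_const c
  have hgm : Measurable fun x => x - (cutoff K x - c) := measurable_id.sub hfm
  set Y : ℕ → Ω → ℝ := fun i ω => cutoff K (X i ω) - c with hY
  set Z : ℕ → Ω → ℝ := fun i ω => X i ω - (cutoff K (X i ω) - c) with hZ
  have hYi : iIndepFun Y P := hi.comp _ fun _ => hfm
  have hZi : iIndepFun Z P := hi.comp _ fun _ => hgm
  have hYm : ∀ i, Measurable (Y i) := fun i => hfm.comp (hm i)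
  have hZm : ∀ i, Measurable (Z i) := fun i => hgm.comp (hm i)
  have hXL : ∀ i, MemLp (X i) 2 P := fun i => ((hid i).memLp_iff).mpr hL
  have hYb : ∀ i ω, |Y i ω| ≤ 2 * K := fun i ω =>
    (abs_sub _ _).trans (by linarith [abs_cutoff_le hK0.le (X i ω)])
  have hYL : ∀ i, MemLp (Y i) 2 P := fun i =>
    MemLp.of_bound (hYm i).aestronglyMeasurable _ (Eventually.of_forall (hYb i))
  have hZL : ∀ i, MemLp (Z i) 2 P := fun i => (hXL i).sub (hYL i)
  have hci : Integrable (fun ω => cutoff K (X 0 ω)) P :=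
    Integrable.of_bound ((measurable_cutoff K).comp (hm 0)).aestronglyMeasurable K
      (Eventually.of_forall fun ω => abs_cutoff_le hK0.le _)
  have hY0 : ∀ i, ∫ ω, Y i ω ∂P = 0 := fun i => by
    refine ((hid i).comp hfm).integral_eq.trans ?_
    simp only [Function.comp_apply]
    rw [integral_sub hci (integrable_const _)]
    simp [hc]
  have hZ0 : ∀ i, ∫ ω, Z i ω ∂P = 0 := fun i => by
    have : ∫ ω, X i ω ∂P = 0 := by rw [(hid i).integral_eq, h0]
    have h := integral_sub ((hXL i).integrable one_le_two) ((hYL i).integrable one_le_two)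
    rw [this, hY0, sub_zero] at h
    exact h
  have hZv : ∀ i, ∫ ω, Z i ω ^ 2 ∂P = ∫ ω, Z 0 ω ^ 2 ∂P := fun i =>
    ((hid i).comp (hgm.pow_const 2)).integral_eq
  have hZ2 : ∫ ω, Z 0 ω ^ 2 ∂P ≤ ε / 8 := by
    have hW : Integrable (fun ω => X 0 ω - cutoff K (X 0 ω)) P :=
      ((hXL 0).integrable one_le_two).sub hci
    have e : ∀ ω, Z 0 ω = (X 0 ω - cutoff K (X 0 ω)) -
        ∫ ω, (X 0 ω - cutoff K (X 0 ω)) ∂P := fun ω => by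
      rw [integral_sub ((hXL 0).integrable one_le_two) hci, h0]; simp [hZ, hc]; ring
    simp only [e]
    rw [← variance_eq_integral hW.aemeasurable]
    exact (variance_le_expectation_sq hW.aestronglyMeasurable).trans hK.le
  set M : ℝ := 3 * (2 * K) ^ 4 with hM
  have hM0 : 0 < M := by positivity
  set L : ℝ := 8 * M / ε with hLdef
  have hL0 : 0 < L := by positivity
  refine ⟨ε / (8 * L), by positivity, fun n A hA hPA => ?_⟩
  rcases Nat.eq_zero_or_pos n with rfl | hn
  · simp
  have hn0 : (0 : ℝ) < n := by exact_mod_cast hn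
  have hsm : Measurable fun ω => ∑ i ∈ Finset.range n, Y i ω := by fun_prop
  have hSYb : ∀ ω, |∑ i ∈ Finset.range n, Y i ω| ≤ n * (2 * K) := fun ω =>
    (Finset.abs_sum_le_sum_abs _ _).trans
      ((Finset.sum_le_sum fun i _ => hYb i ω).trans (by simp))
  have hi4 : Integrable (fun ω => (∑ i ∈ Finset.range n, Y i ω) ^ 4) P :=
    Integrable.of_bound (hsm.pow_const 4).aestronglyMeasurable ((n * (2 * K)) ^ 4)
      (Eventually.of_forall fun ω => by
        rw [Real.norm_eq_abs, abs_pow]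
        exact pow_le_pow_left₀ (abs_nonneg _) (hSYb ω) 4)
  have hiZ := (memLp_sum_range hZL n).integrable_sq
  have hpt : ∀ ω, (∑ i ∈ Finset.range n, X i ω) ^ 2 ≤
      2 * (∑ i ∈ Finset.range n, Z i ω) ^ 2 +
        (2 / (L * n) * (∑ i ∈ Finset.range n, Y i ω) ^ 4 + 2 * (L * n)) := fun ω => by
    have e : ∑ i ∈ Finset.range n, X i ω =
        ∑ i ∈ Finset.range n, Z i ω + ∑ i ∈ Finset.range n, Y i ω := by
      rw [← Finset.sum_add_distrib]; simp [hY, hZ]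
    rw [e]
    set z := ∑ i ∈ Finset.range n, Z i ω
    set y := ∑ i ∈ Finset.range n, Y i ω
    have hy : y ^ 2 ≤ y ^ 4 / (L * n) + L * n := by
      have hLn : 0 < L * n := by positivity
      rw [div_add' _ _ _ hLn.ne', le_div_iff₀ hLn]
      nlinarith [sq_nonneg (y ^ 2 - L * n), sq_nonneg (y ^ 2), sq_nonneg (L * n)]
    have : 2 / (L * n) * y ^ 4 = 2 * (y ^ 4 / (L * n)) := by ring
    rw [this]
    nlinarith [sq_nonneg (z - y)]
  calc ∫ ω in A, (∑ i ∈ Finset.range n, X i ω) ^ 2 ∂P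
      ≤ ∫ ω in A, (2 * (∑ i ∈ Finset.range n, Z i ω) ^ 2 +
        (2 / (L * n) * (∑ i ∈ Finset.range n, Y i ω) ^ 4 + 2 * (L * n))) ∂P :=
        integral_mono (memLp_sum_range hXL n).integrable_sq.integrableOn
          (((hiZ.const_mul 2).fun_add ((hi4.const_mul _).fun_add (integrable_const _))).integrableOn)
          hpt
    _ = 2 * ∫ ω in A, (∑ i ∈ Finset.range n, Z i ω) ^ 2 ∂P +
        (2 / (L * n) * ∫ ω in A, (∑ i ∈ Finset.range n, Y i ω) ^ 4 ∂P +
          P.real A * (2 * (L * n))) := by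
        rw [integral_add (hiZ.const_mul 2).integrableOn
          ((hi4.const_mul _).fun_add (integrable_const _)).integrableOn,
          integral_add (hi4.const_mul _).integrableOn (integrable_const _), integral_const_mul,
          integral_const_mul, setIntegral_const, smul_eq_mul]
    _ ≤ 2 * (n * (ε / 8)) + (2 / (L * n) * (M * n ^ 2) + ε / (8 * L) * (2 * (L * n))) := by
        have h1 : ∫ ω in A, (∑ i ∈ Finset.range n, Z i ω) ^ 2 ∂P ≤ n * (ε / 8) :=
          (setIntegral_le_integral hiZ (Eventually.of_forall fun ω => sq_nonneg _)).trans
            ((integral_sq_sum_range hZi hZL hZ0 hZv n).le.trans (by gcongr))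
        have h2 : ∫ ω in A, (∑ i ∈ Finset.range n, Y i ω) ^ 4 ∂P ≤ M * n ^ 2 :=
          (setIntegral_le_integral hi4 (Eventually.of_forall fun ω => by positivity)).trans
            (integral_pow_four_sum_range_le hYi hYm hYb hY0 n)
        gcongr
    _ ≤ ε * n := by
        have e1 : 2 / (L * n) * (M * n ^ 2) = ε / 4 * n := by
          rw [hLdef]; field_simp; ring
        have e2 : ε / (8 * L) * (2 * (L * n)) = ε / 4 * n := by field_simp; ring
        rw [e1, e2]
        nlinarith

/-! ### The jumps of the walk -/

section Jumps

variable (p : PMF ℤ)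

theorem measurePreserving_jump (i : ℕ) :
    MeasurePreserving (fun ξ : ℕ → ℤ => ξ i) (walkLaw p) p.toMeasure :=
  measurePreserving_eval_infinitePi (fun _ : ℕ => p.toMeasure) i

theorem iIndepFun_jump : iIndepFun (fun (i : ℕ) (ξ : ℕ → ℤ) => ξ i) (walkLaw p) :=
  iIndepFun_infinitePi (X := fun (_ : ℕ) (k : ℤ) => k) fun _ => measurable_id

theorem iIndepFun_comp_jump {f : ℤ → ℝ} :
    iIndepFun (fun (i : ℕ) (ξ : ℕ → ℤ) => f (ξ i)) (walkLaw p) :=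
  iIndepFun_infinitePi (X := fun (_ : ℕ) (k : ℤ) => f k) fun _ => measurable_of_countable f

theorem identDistrib_comp_jump (f : ℤ → ℝ) (i : ℕ) :
    IdentDistrib (fun ξ : ℕ → ℤ => f (ξ i)) (fun ξ => f (ξ 0)) (walkLaw p) (walkLaw p) :=
  IdentDistrib.comp ⟨(measurable_pi_apply i).aemeasurable, (measurable_pi_apply 0).aemeasurable, by
    rw [(measurePreserving_jump p i).map_eq, (measurePreserving_jump p 0).map_eq]⟩
    (measurable_of_countable f)

theorem integral_comp_jump (f : ℤ → ℝ) (i : ℕ) :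
    ∫ ξ, f (ξ i) ∂(walkLaw p) = ∫ k, f k ∂p.toMeasure := by
  rw [← (measurePreserving_jump p i).map_eq,
    integral_map (measurable_pi_apply i).aemeasurable
      (measurable_of_countable f).aestronglyMeasurable]

theorem memLp_comp_jump {f : ℤ → ℝ} (hf : MemLp f 2 p.toMeasure) (i : ℕ) :
    MemLp (fun ξ : ℕ → ℤ => f (ξ i)) 2 (walkLaw p) :=
  hf.comp_measurePreserving (measurePreserving_jump p i)

theorem walk_cast (ξ : ℕ → ℤ) (n : ℕ) : (walk ξ n : ℝ) = ∑ i ∈ Finset.range n, (ξ i : ℝ) := by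
  simp [walk]

variable {p}

theorem memLp_jump (hp_var : Summable fun k : ℤ => (k : ℝ) ^ 2 * (p k).toReal) :
    MemLp (fun k : ℤ => (k : ℝ)) 2 p.toMeasure := by
  have hm := (measurable_of_countable fun k : ℤ => (k : ℝ)).aestronglyMeasurable
    (μ := p.toMeasure)
  rw [memLp_two_iff_integrable_sq hm]
  refine ⟨(hm.pow 2), ?_⟩
  rw [HasFiniteIntegral, lintegral_countable']
  have e : ∀ k : ℤ, ‖(k : ℝ) ^ 2‖ₑ * p.toMeasure {k} =
      ENNReal.ofReal ((k : ℝ) ^ 2 * (p k).toReal) := fun k => by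
    rw [p.toMeasure_apply_singleton k (measurableSet_singleton k),
      Real.enorm_of_nonneg (sq_nonneg _), ENNReal.ofReal_mul (sq_nonneg _),
      ENNReal.ofReal_toReal (p.apply_ne_top k)]
  simp only [e]
  rw [← ENNReal.ofReal_tsum_of_nonneg (fun k => by positivity) hp_var]
  exact ENNReal.ofReal_lt_top

theorem map_neg_toMeasure (hp_symm : ∀ k : ℤ, p (-k) = p k) :
    p.toMeasure.map (fun k => -k) = p.toMeasure := by
  refine Measure.ext_of_singleton fun k => ?_
  rw [Measure.map_apply (measurable_of_countable _) (measurableSet_singleton k)]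
  have : (fun k : ℤ => -k) ⁻¹' {k} = {-k} := by ext x; simp
  rw [this, p.toMeasure_apply_singleton _ (measurableSet_singleton _),
    p.toMeasure_apply_singleton _ (measurableSet_singleton _), hp_symm]

theorem integral_odd_eq_zero (hp_symm : ∀ k : ℤ, p (-k) = p k) {f : ℤ → ℝ}
    (hf : ∀ k, f (-k) = -f k) : ∫ k, f k ∂p.toMeasure = 0 := by
  have h : ∫ k, f k ∂p.toMeasure = ∫ k, f (-k) ∂p.toMeasure := by
    conv_lhs => rw [← map_neg_toMeasure hp_symm]
    rw [integral_map (measurable_of_countable _).aemeasurable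
      (measurable_of_countable f).aestronglyMeasurable]
  simp only [hf, integral_neg] at h
  linarith

theorem integral_jump_eq_zero (hp_symm : ∀ k : ℤ, p (-k) = p k) :
    ∫ k : ℤ, (k : ℝ) ∂p.toMeasure = 0 := integral_odd_eq_zero hp_symm fun k => by simp

theorem meanAbsJump_eq (hL : MemLp (fun k : ℤ => (k : ℝ)) 2 p.toMeasure) :
    meanAbsJump p = ∫ k : ℤ, |(k : ℝ)| ∂p.toMeasure := by
  rw [PMF.integral_eq_tsum _ _ (hL.integrable one_le_two).abs]
  simp [meanAbsJump, mul_comm]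

theorem integral_sq_walk (hp_symm : ∀ k : ℤ, p (-k) = p k)
    (hL : MemLp (fun k : ℤ => (k : ℝ)) 2 p.toMeasure) (n : ℕ) :
    ∫ ξ, (walk ξ n : ℝ) ^ 2 ∂(walkLaw p) = n * ∫ k : ℤ, (k : ℝ) ^ 2 ∂p.toMeasure := by
  simp only [walk_cast]
  exact integral_sq_sum_range (iIndepFun_comp_jump p (f := fun k => (k : ℝ)))
    (memLp_comp_jump p hL)
    (fun i => (integral_comp_jump p (fun k => (k : ℝ)) i).trans (integral_jump_eq_zero hp_symm))
    (fun i => integral_comp_jump p (fun k => (k : ℝ) ^ 2) i) n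

theorem memLp_walk (hL : MemLp (fun k : ℤ => (k : ℝ)) 2 p.toMeasure) (n : ℕ) :
    MemLp (fun ξ => (walk ξ n : ℝ)) 2 (walkLaw p) := by
  simp only [walk_cast]
  exact memLp_sum_range (memLp_comp_jump p hL) n

theorem scaledMoment_two (hp_symm : ∀ k : ℤ, p (-k) = p k)
    (hL : MemLp (fun k : ℤ => (k : ℝ)) 2 p.toMeasure) {n : ℕ} (hn : n ≠ 0) :
    scaledMoment p 2 n = ENNReal.ofReal (∫ k : ℤ, (k : ℝ) ^ 2 ∂p.toMeasure) := by
  have e : ∀ ξ : ℕ → ℤ, |(walk ξ n : ℝ)| ^ (2 : ℝ) = (walk ξ n : ℝ) ^ 2 := fun ξ => by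
    rw [Real.rpow_two, sq_abs]
  simp only [scaledMoment, e]
  rw [← ofReal_integral_eq_lintegral_ofReal (memLp_walk hL n).integrable_sq
    (Eventually.of_forall fun ξ => sq_nonneg _), integral_sq_walk hp_symm hL,
    ENNReal.ofReal_mul (by positivity), ENNReal.ofReal_natCast]
  norm_num
  rw [mul_comm, ENNReal.mul_div_cancel_right (by simpa using hn) (by simp)]

theorem tendsto_scaledMoment_two (hp_symm : ∀ k : ℤ, p (-k) = p k)
    (hL : MemLp (fun k : ℤ => (k : ℝ)) 2 p.toMeasure) :
    Tendsto (scaledMoment p 2) atTop (𝓝 (ENNReal.ofReal (∫ k : ℤ, (k : ℝ) ^ 2 ∂p.toMeasure))) :=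
  tendsto_const_nhds.congr' <| by
    filter_upwards [eventually_ne_atTop 0] with n hn
    rw [scaledMoment_two hp_symm hL hn]

theorem exists_apply_pos (hp_var_pos : 0 < ∑' k : ℤ, (k : ℝ) ^ 2 * (p k).toReal) :
    ∃ k : ℤ, k ≠ 0 ∧ p k ≠ 0 := by
  by_contra! h
  refine hp_var_pos.ne' ?_
  convert! tsum_zero with k
  rcases eq_or_ne k 0 with rfl | hk
  · simp
  · simp [h k hk]

theorem apply_one_ne_zero (hp_symm : ∀ k : ℤ, p (-k) = p k)
    (hp_mono : ∀ k : ℤ, 1 ≤ k → p (k + 1) ≤ p k)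
    (hp_var_pos : 0 < ∑' k : ℤ, (k : ℝ) ^ 2 * (p k).toReal) : p 1 ≠ 0 := by
  obtain ⟨k, hk, hpk⟩ := exists_apply_pos hp_var_pos
  have hle : ∀ m : ℕ, p ((m : ℤ) + 1) ≤ p 1 := fun m => by
    induction m with
    | zero => simp
    | succ m ih =>
      have := hp_mono ((m : ℤ) + 1) (by omega)
      push_cast
      exact this.trans ih
  have hpa : p |k| ≠ 0 := by
    rcases abs_choice k with h | h <;> rw [h]
    · exact hpk
    · rwa [hp_symm]
  intro h1
  have := hle (|k| - 1).toNat
  rw [Int.toNat_of_nonneg (by have := abs_pos.mpr hk; omega), sub_add_cancel, h1] at this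
  exact hpa (le_antisymm this bot_le)

theorem meanAbsJump_pos (hL : MemLp (fun k : ℤ => (k : ℝ)) 2 p.toMeasure) (h1 : p 1 ≠ 0) :
    0 < meanAbsJump p := by
  rw [meanAbsJump_eq hL]
  have h := setIntegral_le_integral (s := {(1 : ℤ)}) (hL.integrable one_le_two).abs
    (Eventually.of_forall fun k => abs_nonneg _)
  refine lt_of_lt_of_le ?_ h
  rw [integral_singleton, measureReal_def,
    p.toMeasure_apply_singleton _ (measurableSet_singleton _)]
  simpa using ENNReal.toReal_pos h1 (p.apply_ne_top 1)

end Jumps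

/-! ### Decay of the point probabilities -/

section Fourier

variable (p : PMF ℤ)

/-- The characteristic function of a jump. -/
noncomputable def jumpCharFun (θ : ℝ) : ℂ := charFun (p.toMeasure.map fun k : ℤ => (k : ℝ)) θ

theorem jumpCharFun_eq (θ : ℝ) :
    jumpCharFun p θ = ∫ k : ℤ, Complex.exp (θ * k * Complex.I) ∂p.toMeasure := by
  rw [jumpCharFun, charFun_apply_real, integral_map
    (measurable_of_countable _).aemeasurable (by fun_prop)]
  simp

theorem continuous_jumpCharFun : Continuous (jumpCharFun p) := by
  have : IsProbabilityMeasure (p.toMeasure.map fun k : ℤ => (k : ℝ)) :=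
    Measure.isProbabilityMeasure_map (measurable_of_countable _).aemeasurable
  exact continuous_charFun

theorem norm_jumpCharFun_le_one (θ : ℝ) : ‖jumpCharFun p θ‖ ≤ 1 := by
  have : IsProbabilityMeasure (p.toMeasure.map fun k : ℤ => (k : ℝ)) :=
    Measure.isProbabilityMeasure_map (measurable_of_countable _).aemeasurable
  exact norm_charFun_le_one _

theorem integral_exp_sum_jump (s : Finset ℕ) (θ : ℝ) :
    ∫ ξ, Complex.exp (θ * (∑ i ∈ s, ξ i : ℤ) * Complex.I) ∂(walkLaw p) =
      jumpCharFun p θ ^ s.card := by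
  have h := (iIndepFun.precomp (g := ((↑) : s → ℕ)) Subtype.val_injective
    (iIndepFun_comp_jump p (f := fun k => (k : ℝ)))).charFun_map_fun_finsetSum_eq_prod
      (X := fun (i : ℕ) (ξ : ℕ → ℤ) => (ξ i : ℝ))
      fun i _ => (measurable_of_countable _).comp (measurable_pi_apply i) |>.aemeasurable
  have e : ∀ i, (walkLaw p).map (fun ξ : ℕ → ℤ => (ξ i : ℝ)) =
      p.toMeasure.map fun k : ℤ => (k : ℝ) := fun i => by
    rw [← (measurePreserving_jump p i).map_eq, Measure.map_map
      (measurable_of_countable fun k : ℤ => (k : ℝ)) (measurable_pi_apply i)]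
    rfl
  simp only [e, Finset.prod_const] at h
  have h' := congrFun h θ
  have hm : Measurable fun ξ : ℕ → ℤ => ∑ i ∈ s, (ξ i : ℝ) :=
    Finset.measurable_sum _ fun i _ =>
      (measurable_of_countable fun k : ℤ => (k : ℝ)).comp (measurable_pi_apply i)
  rw [Pi.pow_apply, charFun_apply_real, integral_map hm.aemeasurable (by fun_prop)] at h'
  rw [jumpCharFun, ← h']
  push_cast
  rfl

theorem integral_exp_int_mul (m : ℤ) :
    ∫ θ in Set.Ioc (-Real.pi) Real.pi, Complex.exp (θ * m * Complex.I) =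
      if m = 0 then (2 * Real.pi : ℂ) else 0 := by
  rw [← intervalIntegral.integral_of_le (by linarith [Real.pi_pos])]
  split_ifs with hm
  · simp [hm]; ring
  · have hc : (m * Complex.I : ℂ) ≠ 0 := by simp [hm]
    have e : ∀ θ : ℝ, Complex.exp (θ * m * Complex.I) = Complex.exp (m * Complex.I * θ) :=
      fun θ => by ring_nf
    simp only [e]
    rw [integral_exp_mul_complex hc, div_eq_zero_iff, sub_eq_zero, Complex.exp_eq_exp_iff_exists_int]
    exact Or.inl ⟨m, by push_cast; ring⟩

/-- A bound for the point probabilities of a sum of `m` jumps. -/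
noncomputable def concentration (m : ℕ) : ℝ :=
  (2 * Real.pi)⁻¹ * ∫ θ in Set.Ioc (-Real.pi) Real.pi, ‖jumpCharFun p θ‖ ^ m

theorem concentration_nonneg (m : ℕ) : 0 ≤ concentration p m :=
  mul_nonneg (by positivity) (integral_nonneg fun θ => by positivity)

theorem measure_sum_jump_eq_le (s : Finset ℕ) (x : ℤ) :
    walkLaw p {ξ | ∑ i ∈ s, ξ i = x} ≤ ENNReal.ofReal (concentration p s.card) := by
  have hms : Measurable fun ξ : ℕ → ℤ => ∑ i ∈ s, ξ i := by fun_prop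
  have hA : MeasurableSet {ξ : ℕ → ℤ | ∑ i ∈ s, ξ i = x} := hms (measurableSet_singleton x)
  rw [← ENNReal.ofReal_toReal (measure_ne_top (walkLaw p) _)]
  refine ENNReal.ofReal_le_ofReal ?_
  rw [← measureReal_def, concentration, ← div_eq_inv_mul, le_div_iff₀ (by positivity)]
  have hint : Integrable (Function.uncurry fun (ξ : ℕ → ℤ) (θ : ℝ) =>
      Complex.exp (θ * ((∑ i ∈ s, ξ i - x : ℤ) : ℂ) * Complex.I))
      ((walkLaw p).prod (volume.restrict (Set.Ioc (-Real.pi) Real.pi))) := by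
    refine Integrable.of_bound (Measurable.aestronglyMeasurable ?_) 1
      (Eventually.of_forall fun z => ?_)
    · have : Measurable fun z : (ℕ → ℤ) × ℝ => ((∑ i ∈ s, z.1 i - x : ℤ) : ℂ) :=
        (measurable_of_countable fun k : ℤ => ((k - x : ℤ) : ℂ)).comp (hms.comp measurable_fst)
      simp only [Function.uncurry_def]
      fun_prop
    · simp only [Function.uncurry_def]
      have := Complex.norm_exp_ofReal_mul_I (z.2 * ((∑ i ∈ s, z.1 i - x : ℤ) : ℝ))
      push_cast at this ⊢
      exact this.le
  have hswap := integral_integral_swap hint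
  simp only [integral_exp_int_mul] at hswap
  have h1 : ∫ ξ, (if ∑ i ∈ s, ξ i - x = 0 then (2 * Real.pi : ℂ) else 0) ∂(walkLaw p) =
      ((walkLaw p).real {ξ | ∑ i ∈ s, ξ i = x} * (2 * Real.pi) : ℝ) := by
    have : (fun ξ : ℕ → ℤ => if ∑ i ∈ s, ξ i - x = 0 then (2 * Real.pi : ℂ) else 0) =
        {ξ | ∑ i ∈ s, ξ i = x}.indicator fun _ => (2 * Real.pi : ℂ) := by
      ext ξ; simp [Set.indicator_apply, sub_eq_zero]
    rw [this, integral_indicator hA, setIntegral_const]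
    simp
  have h2 : ∀ θ : ℝ, ∫ ξ, Complex.exp (θ * ((∑ i ∈ s, ξ i - x : ℤ) : ℂ) * Complex.I) ∂(walkLaw p) =
      jumpCharFun p θ ^ s.card * Complex.exp (-(θ * x) * Complex.I) := fun θ => by
    rw [← integral_exp_sum_jump, ← integral_mul_const]
    congr 1
    ext ξ
    rw [← Complex.exp_add]
    push_cast
    ring_nf
  simp only [h1, h2] at hswap
  have h3 : (walkLaw p).real {ξ | ∑ i ∈ s, ξ i = x} * (2 * Real.pi) =
      ‖(((walkLaw p).real {ξ | ∑ i ∈ s, ξ i = x} * (2 * Real.pi) : ℝ) : ℂ)‖ := by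
    rw [Complex.norm_real, Real.norm_of_nonneg (by positivity)]
  rw [h3, hswap]
  refine (norm_integral_le_integral_norm _).trans (le_of_eq ?_)
  congr 1
  ext θ
  have := Complex.norm_exp_ofReal_mul_I (-(θ * x))
  push_cast at this
  rw [norm_mul, this, mul_one, norm_pow]

variable {p}

theorem norm_jumpCharFun_lt_one (hp_symm : ∀ k : ℤ, p (-k) = p k) (h1 : p 1 ≠ 0) {θ : ℝ}
    (hθ : θ ∈ Set.Ioo (-Real.pi) Real.pi) (h0 : θ ≠ 0) : ‖jumpCharFun p θ‖ < 1 := by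
  have hb : ∀ f : ℤ → ℝ, (∀ k, |f k| ≤ 2) → Integrable f p.toMeasure := fun f hf =>
    Integrable.of_bound (measurable_of_countable f).aestronglyMeasurable 2 (Eventually.of_forall hf)
  have hc : Integrable (fun k : ℤ => Real.cos (θ * k)) p.toMeasure :=
    hb _ fun k => (Real.abs_cos_le_one _).trans one_le_two
  have hs : Integrable (fun k : ℤ => Real.sin (θ * k)) p.toMeasure :=
    hb _ fun k => (Real.abs_sin_le_one _).trans one_le_two
  have e : jumpCharFun p θ = ((∫ k : ℤ, Real.cos (θ * k) ∂p.toMeasure : ℝ) : ℂ) := by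
    have hz := integral_odd_eq_zero hp_symm (f := fun k : ℤ => Real.sin (θ * k)) fun k => by simp
    have h : ∀ k : ℤ, Complex.exp (θ * k * Complex.I) =
        ((Real.cos (θ * k) : ℝ) : ℂ) + ((Real.sin (θ * k) : ℝ) : ℂ) * Complex.I := fun k => by
      rw [Complex.exp_mul_I]; push_cast; rfl
    simp only [jumpCharFun_eq, h]
    rw [integral_add hc.ofReal (hs.ofReal.mul_const _), integral_mul_const,
      integral_complex_ofReal, integral_complex_ofReal, hz]
    simp
  have hsin : Real.sin θ ≠ 0 := fun h =>
    h0 ((Real.sin_eq_zero_iff_of_lt_of_lt hθ.1 hθ.2).mp h)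
  have hcos : Real.cos θ ^ 2 < 1 := by
    have := Real.sin_sq_add_cos_sq θ
    have := pow_pos (abs_pos.mpr hsin) 2
    rw [sq_abs] at this
    linarith
  have hcos' := abs_lt.mp ((sq_lt_one_iff_abs_lt_one _).mp hcos)
  have hp1 : 0 < (p 1).toReal := ENNReal.toReal_pos h1 (p.apply_ne_top 1)
  have key : ∀ f : ℤ → ℝ, (∀ k, |f k| ≤ 2) → (∀ k, 0 ≤ f k) → 0 < f 1 →
      0 < ∫ k, f k ∂p.toMeasure := fun f hf hf0 hf1 => by
    refine lt_of_lt_of_le ?_ (setIntegral_le_integral (s := {(1 : ℤ)}) (hb f hf)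
      (Eventually.of_forall hf0))
    rw [integral_singleton, measureReal_def,
      p.toMeasure_apply_singleton _ (measurableSet_singleton _), smul_eq_mul]
    positivity
  rw [e, Complex.norm_real, Real.norm_eq_abs, abs_lt]
  constructor
  · have h := key (fun k => 1 + Real.cos (θ * k))
      (fun k => (abs_add_le _ _).trans (by simpa using
        (by linarith [Real.abs_cos_le_one (θ * k)] : (1 : ℝ) + |Real.cos (θ * k)| ≤ 2)))
      (fun k => by linarith [Real.neg_one_le_cos (θ * k)]) (by simp; linarith)
    rw [integral_add (integrable_const _) hc] at h
    simp at h
    linarith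
  · have h := key (fun k => 1 - Real.cos (θ * k))
      (fun k => (abs_sub _ _).trans (by simpa using
        (by linarith [Real.abs_cos_le_one (θ * k)] : (1 : ℝ) + |Real.cos (θ * k)| ≤ 2)))
      (fun k => by linarith [Real.cos_le_one (θ * k)]) (by simp; linarith)
    rw [integral_sub (integrable_const _) hc] at h
    simp at h
    linarith

theorem tendsto_concentration (hp_symm : ∀ k : ℤ, p (-k) = p k) (h1 : p 1 ≠ 0) :
    Tendsto (concentration p) atTop (𝓝 0) := by
  have h : Tendsto (fun m : ℕ => ∫ θ in Set.Ioc (-Real.pi) Real.pi, ‖jumpCharFun p θ‖ ^ m) atTop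
      (𝓝 (∫ θ in Set.Ioc (-Real.pi) Real.pi, (0 : ℝ))) := by
    refine tendsto_integral_of_dominated_convergence (fun _ => 1) (fun m => ?_)
      (integrable_const _) (fun m => Eventually.of_forall fun θ => ?_) ?_
    · exact ((continuous_jumpCharFun p).norm.pow m).aestronglyMeasurable
    · rw [norm_pow, norm_norm]
      exact pow_le_one₀ (norm_nonneg _) (norm_jumpCharFun_le_one p θ)
    · rw [ae_restrict_iff' measurableSet_Ioc]
      have hne : ∀ x : ℝ, ∀ᵐ θ : ℝ, θ ≠ x := fun x => by simp [ae_iff]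
      filter_upwards [hne 0, hne Real.pi] with θ hθ0 hθπ hθ
      exact tendsto_pow_atTop_nhds_zero_of_lt_one (norm_nonneg _)
        (norm_jumpCharFun_lt_one hp_symm h1 ⟨hθ.1, lt_of_le_of_ne hθ.2 hθπ⟩ hθ0)
  have h' := h.const_mul (2 * Real.pi)⁻¹
  rwa [integral_zero, mul_zero] at h'

end Fourier

/-! ### Edges crossed by the walk -/

/-- The edges crossed by a jump `a` from the origin; the edge `j` joins `j - 1` and `j`. -/
noncomputable def jumpEdges (a : ℤ) : Finset ℤ := Finset.Ioc (min 0 a) (max 0 a)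

/-- The edges crossed between the positions `x` and `y`. -/
noncomputable def edges (x y : ℤ) : Finset ℤ := Finset.Ioc (min x y) (max x y)

theorem card_jumpEdges (a : ℤ) : (jumpEdges a).card = a.natAbs := by
  rw [jumpEdges, Int.card_Ioc]
  omega

theorem edges_add (x a : ℤ) : edges x (x + a) = (jumpEdges a).map (addLeftEmbedding x) := by
  ext j
  simp only [edges, jumpEdges, Finset.mem_Ioc, Finset.mem_map, addLeftEmbedding_apply]
  constructor
  · intro h
    exact ⟨j - x, by omega, by omega⟩
  · rintro ⟨u, hu, rfl⟩
    omega

theorem walk_succ (ξ : ℕ → ℤ) (n : ℕ) : walk ξ (n + 1) = walk ξ n + ξ n := by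
  simp [walk, Finset.sum_range_succ]

/-- The edges crossed during the jump number `k + 1`. -/
noncomputable def crossed (ξ : ℕ → ℤ) (k : ℕ) : Finset ℤ := edges (walk ξ k) (walk ξ (k + 1))

theorem crossed_eq (ξ : ℕ → ℤ) (k : ℕ) :
    crossed ξ k = (jumpEdges (ξ k)).map (addLeftEmbedding (walk ξ k)) := by
  rw [crossed, walk_succ, edges_add]

theorem card_crossed (ξ : ℕ → ℤ) (k : ℕ) : (crossed ξ k).card = (ξ k).natAbs := by
  rw [crossed_eq, Finset.card_map, card_jumpEdges]

theorem card_crossed_inter (ξ : ℕ → ℤ) {k l : ℕ} (hkl : k < l) :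
    (crossed ξ k ∩ crossed ξ l).card = ∑ u ∈ jumpEdges (ξ k), ∑ v ∈ jumpEdges (ξ l),
      if ∑ i ∈ Finset.Ioo k l, ξ i = u - v - ξ k then 1 else 0 := by
  have hw : walk ξ l = walk ξ k + ξ k + ∑ i ∈ Finset.Ioo k l, ξ i := by
    rw [← walk_succ, walk, walk, ← Finset.sum_range_add_sum_Ico _ (show k + 1 ≤ l from hkl)]
    congr 1
  have h : (crossed ξ k ∩ crossed ξ l).card =
      ∑ x ∈ crossed ξ k, ∑ y ∈ crossed ξ l, if x = y then 1 else 0 := by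
    simp only [Finset.sum_ite_eq, Finset.sum_boole, Finset.filter_mem_eq_inter]
    rfl
  rw [h, crossed_eq, crossed_eq, Finset.sum_map]
  refine Finset.sum_congr rfl fun u _ => ?_
  rw [Finset.sum_map]
  refine Finset.sum_congr rfl fun v _ => ?_
  simp only [addLeftEmbedding_apply, hw]
  congr 1
  exact propext ⟨fun h => by omega, fun h => by omega⟩

variable {p : PMF ℤ}

theorem lintegral_natAbs (hL : MemLp (fun k : ℤ => (k : ℝ)) 2 p.toMeasure) :
    ∫⁻ k : ℤ, (k.natAbs : ℝ≥0∞) ∂p.toMeasure = ENNReal.ofReal (meanAbsJump p) := by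
  rw [meanAbsJump_eq hL, ofReal_integral_eq_lintegral_ofReal (hL.integrable one_le_two).abs
    (Eventually.of_forall fun k => abs_nonneg _)]
  refine lintegral_congr fun k => ?_
  rw [← Int.cast_abs, ← Nat.cast_natAbs, ENNReal.ofReal_natCast]

theorem lintegral_natAbs_jump (hL : MemLp (fun k : ℤ => (k : ℝ)) 2 p.toMeasure) (i : ℕ) :
    ∫⁻ ξ, ((ξ i).natAbs : ℝ≥0∞) ∂(walkLaw p) = ENNReal.ofReal (meanAbsJump p) := by
  rw [← lintegral_natAbs hL]
  exact (measurePreserving_jump p i).lintegral_comp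
    (measurable_of_countable fun k : ℤ => (k.natAbs : ℝ≥0∞))

theorem lintegral_card_crossed_inter_le
    (hL : MemLp (fun k : ℤ => (k : ℝ)) 2 p.toMeasure) {k l : ℕ} (hkl : k < l) :
    ∫⁻ ξ, ((crossed ξ k ∩ crossed ξ l).card : ℝ≥0∞) ∂(walkLaw p) ≤
      ENNReal.ofReal (concentration p (l - k - 1) * meanAbsJump p ^ 2) := by
  set F : (ℤ × ℤ) × ℤ → ℝ≥0∞ := fun z => ∑ u ∈ jumpEdges z.1.1, ∑ v ∈ jumpEdges z.1.2,
    if z.2 = u - v - z.1.1 then 1 else 0 with hF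
  have hFm : Measurable F := measurable_of_countable F
  have e : ∀ ξ : ℕ → ℤ, ((crossed ξ k ∩ crossed ξ l).card : ℝ≥0∞) =
      F ((ξ k, ξ l), ∑ i ∈ Finset.Ioo k l, ξ i) := fun ξ => by
    rw [card_crossed_inter ξ hkl]; simp [hF]
  have hm1 : Measurable fun ξ : ℕ → ℤ => (ξ k, ξ l) := by fun_prop
  have hm2 : Measurable fun ξ : ℕ → ℤ => ∑ i ∈ Finset.Ioo k l, ξ i := by fun_prop
  have hind : IndepFun (fun ξ : ℕ → ℤ => (ξ k, ξ l)) (fun ξ => ∑ i ∈ Finset.Ioo k l, ξ i)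
      (walkLaw p) := by
    have h := (iIndepFun_jump p).indepFun_finset {k, l} (Finset.Ioo k l)
      (by rw [Finset.disjoint_left]; intro x hx; simp at hx ⊢; omega)
      fun i => measurable_pi_apply i
    have h' := h.comp
      (φ := fun g : ({k, l} : Finset ℕ) → ℤ => (g ⟨k, by simp⟩, g ⟨l, by simp⟩))
      (ψ := fun g : (Finset.Ioo k l) → ℤ => ∑ i, g i) (by fun_prop) (by fun_prop)
    convert! h' using 1
    ext ξ
    exact (Finset.sum_coe_sort (Finset.Ioo k l) fun i => ξ i).symm
  have hind2 : IndepFun (fun ξ : ℕ → ℤ => ξ k) (fun ξ => ξ l) (walkLaw p) :=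
    (iIndepFun_jump p).indepFun hkl.ne
  simp only [e]
  rw [← lintegral_map hFm (hm1.prodMk hm2),
    (indepFun_iff_map_prod_eq_prod_map_map hm1.aemeasurable hm2.aemeasurable).mp hind,
    lintegral_prod _ hFm.aemeasurable,
    lintegral_map hFm.lintegral_prod_right' hm1]
  have hinner : ∀ ξ : ℕ → ℤ, ∫⁻ y, F ((ξ k, ξ l), y)
      ∂((walkLaw p).map fun ξ => ∑ i ∈ Finset.Ioo k l, ξ i) ≤
      ENNReal.ofReal (concentration p (l - k - 1)) *
        (((ξ k).natAbs : ℝ≥0∞) * ((ξ l).natAbs : ℝ≥0∞)) := fun ξ => by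
    simp only [hF]
    rw [lintegral_finsetSum _ fun u _ => measurable_of_countable _]
    simp only [lintegral_finsetSum _ fun v _ => measurable_of_countable _]
    have hle : ∀ x : ℤ, ∫⁻ y, (if y = x then 1 else 0)
        ∂((walkLaw p).map fun ξ => ∑ i ∈ Finset.Ioo k l, ξ i) ≤
        ENNReal.ofReal (concentration p (l - k - 1)) := fun x => by
      have hx : (fun y : ℤ => if y = x then (1 : ℝ≥0∞) else 0) = ({x} : Set ℤ).indicator 1 := by
        ext y; simp [Set.indicator_apply]
      rw [hx, lintegral_indicator_one (measurableSet_singleton x),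
        Measure.map_apply hm2 (measurableSet_singleton x)]
      have := measure_sum_jump_eq_le p (Finset.Ioo k l) x
      rw [Nat.card_Ioo] at this
      exact this
    refine (Finset.sum_le_sum fun u _ => Finset.sum_le_sum fun v _ => hle _).trans (le_of_eq ?_)
    simp only [Finset.sum_const, card_jumpEdges, nsmul_eq_mul]
    ring
  refine (lintegral_mono hinner).trans (le_of_eq ?_)
  have hmk : ∀ i, Measurable fun ξ : ℕ → ℤ => ((ξ i).natAbs : ℝ≥0∞) := fun i =>
    (measurable_of_countable fun a : ℤ => (a.natAbs : ℝ≥0∞)).comp (measurable_pi_apply i)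
  rw [lintegral_const_mul _ ((hmk k).fun_mul (hmk l))]
  have h := lintegral_mul_eq_lintegral_mul_lintegral_of_indepFun (hmk k) (hmk l)
    (hind2.comp (measurable_of_countable fun a : ℤ => (a.natAbs : ℝ≥0∞))
      (measurable_of_countable fun a : ℤ => (a.natAbs : ℝ≥0∞)))
  simp only [Pi.mul_apply] at h
  rw [h, lintegral_natAbs_jump hL, lintegral_natAbs_jump hL,
    ENNReal.ofReal_mul (concentration_nonneg p _), pow_two, ENNReal.ofReal_mul]
  rw [meanAbsJump_eq hL]
  exact integral_nonneg fun k => abs_nonneg _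

/-- The number of pairs of crossings of a common edge during the first `n` jumps. -/
noncomputable def crossingPairs (ξ : ℕ → ℤ) (n : ℕ) : ℕ :=
  ∑ k ∈ Finset.range n, ∑ l ∈ Finset.range n, (crossed ξ k ∩ crossed ξ l).card

theorem crossingPairs_succ (ξ : ℕ → ℤ) (n : ℕ) :
    crossingPairs ξ (n + 1) = crossingPairs ξ n +
      2 * (∑ k ∈ Finset.range n, (crossed ξ k ∩ crossed ξ n).card) + (ξ n).natAbs := by
  simp only [crossingPairs, Finset.sum_range_succ, Finset.sum_add_distrib, Finset.inter_self,
    card_crossed]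
  have : ∑ k ∈ Finset.range n, (crossed ξ n ∩ crossed ξ k).card =
      ∑ k ∈ Finset.range n, (crossed ξ k ∩ crossed ξ n).card :=
    Finset.sum_congr rfl fun k _ => by rw [Finset.inter_comm]
  omega

theorem measurable_card_crossed_inter (k l : ℕ) :
    Measurable fun ξ : ℕ → ℤ => ((crossed ξ k ∩ crossed ξ l).card : ℝ≥0∞) := by
  have hF : Measurable fun z : (ℤ × ℤ) × (ℤ × ℤ) =>
      ((edges z.1.1 z.1.2 ∩ edges z.2.1 z.2.2).card : ℝ≥0∞) := measurable_of_countable _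
  simp only [crossed]
  exact Measurable.comp (f := fun ξ : ℕ → ℤ =>
    ((walk ξ k, walk ξ (k + 1)), (walk ξ l, walk ξ (l + 1)))) hF
    (((measurable_walk k).prodMk (measurable_walk (k + 1))).prodMk
      ((measurable_walk l).prodMk (measurable_walk (l + 1))))

theorem measurable_crossingPairs (n : ℕ) :
    Measurable fun ξ : ℕ → ℤ => (crossingPairs ξ n : ℝ≥0∞) := by
  simp only [crossingPairs, Nat.cast_sum]
  exact Finset.measurable_sum _ fun k _ => Finset.measurable_sum _ fun l _ =>
    measurable_card_crossed_inter k l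

theorem lintegral_crossingPairs_le (hL : MemLp (fun k : ℤ => (k : ℝ)) 2 p.toMeasure) (n : ℕ) :
    ∫⁻ ξ, (crossingPairs ξ n : ℝ≥0∞) ∂(walkLaw p) ≤
      ENNReal.ofReal (n * (meanAbsJump p + 2 * (meanAbsJump p ^ 2 *
        ∑ m ∈ Finset.range n, concentration p m))) := by
  have hm0 : 0 ≤ meanAbsJump p := by
    rw [meanAbsJump_eq hL]; exact integral_nonneg fun k => abs_nonneg _
  have hG : ∀ n, 0 ≤ ∑ m ∈ Finset.range n, concentration p m := fun n =>
    Finset.sum_nonneg fun m _ => concentration_nonneg p m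
  induction n with
  | zero => simp [crossingPairs]
  | succ n ih =>
    have hms : Measurable fun ξ : ℕ → ℤ =>
        ∑ k ∈ Finset.range n, ((crossed ξ k ∩ crossed ξ n).card : ℝ≥0∞) :=
      Finset.measurable_sum _ fun k _ => measurable_card_crossed_inter k n
    simp only [crossingPairs_succ, Nat.cast_add, Nat.cast_mul, Nat.cast_ofNat, Nat.cast_sum]
    rw [lintegral_add_left ((measurable_crossingPairs n).fun_add (hms.const_mul 2)),
      lintegral_add_left (measurable_crossingPairs n), lintegral_const_mul _ hms,
      lintegral_finsetSum _ fun k _ => measurable_card_crossed_inter k n,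
      lintegral_natAbs_jump hL]
    have h2 : ∑ k ∈ Finset.range n,
        ∫⁻ ξ, ((crossed ξ k ∩ crossed ξ n).card : ℝ≥0∞) ∂(walkLaw p) ≤
        ENNReal.ofReal (meanAbsJump p ^ 2 * ∑ m ∈ Finset.range n, concentration p m) := by
      refine (Finset.sum_le_sum fun k hk => lintegral_card_crossed_inter_le hL
        (Finset.mem_range.mp hk)).trans ?_
      rw [← ENNReal.ofReal_sum_of_nonneg fun k _ =>
        mul_nonneg (concentration_nonneg p _) (sq_nonneg _), ← Finset.sum_mul, mul_comm,
        ← Finset.sum_range_reflect (concentration p) n]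
      refine ENNReal.ofReal_le_ofReal (le_of_eq ?_)
      congr 1
      refine Finset.sum_congr rfl fun k _ => ?_
      congr 1
      omega
    refine (add_le_add (add_le_add ih (mul_le_mul_right h2 2)) le_rfl).trans ?_
    have h2' : (2 : ℝ≥0∞) = ENNReal.ofReal 2 := by simp
    have := hG n
    have hq := concentration_nonneg p n
    rw [h2', ← ENNReal.ofReal_mul zero_le_two, ← ENNReal.ofReal_add (by positivity)
      (by positivity), ← ENNReal.ofReal_add (by positivity) hm0]
    refine ENNReal.ofReal_le_ofReal ?_
    rw [Finset.sum_range_succ]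
    have : 0 ≤ 2 * (meanAbsJump p ^ 2 * concentration p n) := by positivity
    push_cast
    nlinarith [mul_nonneg (Nat.cast_nonneg (α := ℝ) n) this]

theorem tendsto_crossingPairs_bound (hp_symm : ∀ k : ℤ, p (-k) = p k) (h1 : p 1 ≠ 0) :
    Tendsto (fun n : ℕ => (n * (meanAbsJump p + 2 * (meanAbsJump p ^ 2 *
      ∑ m ∈ Finset.range n, concentration p m))) / (n : ℝ) ^ 2) atTop (𝓝 0) := by
  have hc := (tendsto_concentration hp_symm h1).cesaro
  have h := (tendsto_const_div_atTop_nhds_zero_nat (meanAbsJump p)).add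
    (hc.const_mul (2 * meanAbsJump p ^ 2))
  rw [mul_zero, add_zero] at h
  refine h.congr' ?_
  filter_upwards [eventually_ne_atTop 0] with n hn
  have : (n : ℝ) ≠ 0 := by exact_mod_cast hn
  field_simp

/-! ### The collision times -/

section Gaps

variable (ν : Measure ℝ) [IsProbabilityMeasure ν]

/-- The law of the gaps. -/
noncomputable def gapLaw : Measure (ℤ → ℝ) := Measure.infinitePi fun _ : ℤ => ν

instance : IsProbabilityMeasure (gapLaw ν) := by unfold gapLaw; infer_instance

theorem measurePreserving_gap (j : ℤ) :
    MeasurePreserving (fun ζ : ℤ → ℝ => ζ j) (gapLaw ν) ν :=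
  measurePreserving_eval_infinitePi (fun _ : ℤ => ν) j

theorem iIndepFun_comp_gap {f : ℝ → ℝ} (hf : Measurable f) :
    iIndepFun (fun (j : ℤ) (ζ : ℤ → ℝ) => f (ζ j)) (gapLaw ν) :=
  iIndepFun_infinitePi (X := fun (_ : ℤ) (x : ℝ) => f x) fun _ => hf

theorem integral_comp_gap {f : ℝ → ℝ} (hf : Measurable f) (j : ℤ) :
    ∫ ζ, f (ζ j) ∂(gapLaw ν) = ∫ x, f x ∂ν := by
  have h := integral_map (μ := gapLaw ν) (measurable_pi_apply j).aemeasurable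
    (hf.aestronglyMeasurable (μ := (gapLaw ν).map fun ζ => ζ j))
  rw [(measurePreserving_gap ν j).map_eq] at h
  exact h.symm

/-- The sum of `f` over the gaps crossed during the first `n` jumps, with multiplicity. -/
noncomputable def crossingSum (f : ℝ → ℝ) (n : ℕ) (z : (ℤ → ℝ) × (ℕ → ℤ)) : ℝ :=
  ∑ k ∈ Finset.range n, ∑ j ∈ crossed z.2 k, f (z.1 j)

theorem measurable_crossingSum {f : ℝ → ℝ} (hf : Measurable f) (n : ℕ) :
    Measurable (crossingSum f n) := by
  unfold crossingSum
  refine Finset.measurable_sum _ fun k _ => ?_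
  have h : Measurable fun y : (ℤ → ℝ) × (ℤ × ℤ) => ∑ j ∈ edges y.2.1 y.2.2, f (y.1 j) :=
    measurable_from_prod_countable_left fun a =>
      (Finset.measurable_sum _ fun j _ => hf.comp (measurable_pi_apply j) :
        Measurable fun ζ : ℤ → ℝ => ∑ j ∈ edges a.1 a.2, f (ζ j))
  simp only [crossed]
  exact Measurable.comp (f := fun z : (ℤ → ℝ) × (ℕ → ℤ) =>
    (z.1, (walk z.2 k, walk z.2 (k + 1)))) h
    (measurable_fst.prodMk (((measurable_walk k).comp measurable_snd).prodMk
      ((measurable_walk (k + 1)).comp measurable_snd)))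

variable {ν}

theorem integral_mul_gap {f : ℝ → ℝ} (hf : Measurable f) (h0 : ∫ x, f x ∂ν = 0) (i j : ℤ) :
    ∫ ζ, f (ζ i) * f (ζ j) ∂(gapLaw ν) = if i = j then ∫ x, f x ^ 2 ∂ν else 0 := by
  split_ifs with h
  · subst h
    simp only [← pow_two]
    exact integral_comp_gap ν (hf.pow_const 2) i
  · have := ((iIndepFun_comp_gap ν hf).indepFun h).integral_mul_eq_mul_integral
      (hf.comp (measurable_pi_apply i)).aestronglyMeasurable
      (hf.comp (measurable_pi_apply j)).aestronglyMeasurable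
    rw [integral_comp_gap ν hf, h0, zero_mul] at this
    exact this

theorem lintegral_sq_crossingSum_le {f : ℝ → ℝ} (hf : Measurable f) (h0 : ∫ x, f x ∂ν = 0)
    {B : ℝ} (hB : ∀ x, |f x| ≤ B) (n : ℕ) (ξ : ℕ → ℤ) :
    ∫⁻ ζ, ENNReal.ofReal (crossingSum f n (ζ, ξ) ^ 2) ∂(gapLaw ν) ≤
      ENNReal.ofReal (B ^ 2) * crossingPairs ξ n := by
  have hprod : ∀ i j, Integrable (fun ζ : ℤ → ℝ => f (ζ i) * f (ζ j)) (gapLaw ν) := fun i j =>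
    Integrable.of_bound ((hf.comp (measurable_pi_apply i)).mul
      (hf.comp (measurable_pi_apply j))).aestronglyMeasurable (B * B)
      (Eventually.of_forall fun ζ => by
        rw [norm_mul]
        exact mul_le_mul (hB _) (hB _) (norm_nonneg _) ((abs_nonneg _).trans (hB 0)))
  have e : ∀ ζ, crossingSum f n (ζ, ξ) ^ 2 = ∑ k ∈ Finset.range n, ∑ l ∈ Finset.range n,
      ∑ i ∈ crossed ξ k, ∑ j ∈ crossed ξ l, f (ζ i) * f (ζ j) := fun ζ => by
    simp only [crossingSum, pow_two, Finset.sum_mul_sum]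
  have hint : Integrable (fun ζ => ∑ k ∈ Finset.range n, ∑ l ∈ Finset.range n,
      ∑ i ∈ crossed ξ k, ∑ j ∈ crossed ξ l, f (ζ i) * f (ζ j)) (gapLaw ν) :=
    integrable_finsetSum _ fun k _ => integrable_finsetSum _ fun l _ =>
      integrable_finsetSum _ fun i _ => integrable_finsetSum _ fun j _ => hprod i j
  have hval : ∫ ζ, crossingSum f n (ζ, ξ) ^ 2 ∂(gapLaw ν) =
      (∫ x, f x ^ 2 ∂ν) * crossingPairs ξ n := by
    simp only [e]
    rw [integral_finsetSum _ fun k _ => integrable_finsetSum _ fun l _ =>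
      integrable_finsetSum _ fun i _ => integrable_finsetSum _ fun j _ => hprod i j]
    simp only [crossingPairs, Nat.cast_sum, Finset.mul_sum]
    refine Finset.sum_congr rfl fun k _ => ?_
    rw [integral_finsetSum _ fun l _ =>
      integrable_finsetSum _ fun i _ => integrable_finsetSum _ fun j _ => hprod i j]
    refine Finset.sum_congr rfl fun l _ => ?_
    rw [integral_finsetSum _ fun i _ => integrable_finsetSum _ fun j _ => hprod i j]
    simp only [integral_finsetSum _ fun j _ => hprod _ j, integral_mul_gap hf h0,
      Finset.sum_ite_eq, ← Finset.sum_filter, Finset.filter_mem_eq_inter, Finset.sum_const,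
      nsmul_eq_mul, mul_comm]
  rw [← ofReal_integral_eq_lintegral_ofReal (by simpa only [e] using hint)
    (Eventually.of_forall fun ζ => sq_nonneg _), hval, ← ENNReal.ofReal_natCast,
    ← ENNReal.ofReal_mul (sq_nonneg _)]
  refine ENNReal.ofReal_le_ofReal (mul_le_mul_of_nonneg_right ?_ (Nat.cast_nonneg _))
  calc ∫ x, f x ^ 2 ∂ν ≤ ∫ x, B ^ 2 ∂ν :=
        integral_mono_of_nonneg (Eventually.of_forall fun x => sq_nonneg _) (integrable_const _)
          (Eventually.of_forall fun x => by
            simp only [← sq_abs (f x)]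
            exact pow_le_pow_left₀ (abs_nonneg _) (hB x) 2)
    _ = B ^ 2 := by simp

theorem lintegral_abs_crossingSum_le {f : ℝ → ℝ} (hf : Measurable f) (n : ℕ) (ξ : ℕ → ℤ) :
    ∫⁻ ζ, ‖crossingSum f n (ζ, ξ)‖ₑ ∂(gapLaw ν) ≤
      (∑ k ∈ Finset.range n, ((ξ k).natAbs : ℝ≥0∞)) * ∫⁻ x, ‖f x‖ₑ ∂ν := by
  have hm : ∀ j : ℤ, Measurable fun ζ : ℤ → ℝ => ‖f (ζ j)‖ₑ := fun j =>
    (hf.comp (measurable_pi_apply j)).enorm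
  calc ∫⁻ ζ, ‖crossingSum f n (ζ, ξ)‖ₑ ∂(gapLaw ν)
      ≤ ∫⁻ ζ, ∑ k ∈ Finset.range n, ∑ j ∈ crossed ξ k, ‖f (ζ j)‖ₑ ∂(gapLaw ν) :=
        lintegral_mono fun ζ => (enorm_sum_le _ _).trans
          (Finset.sum_le_sum fun k _ => enorm_sum_le _ _)
    _ = ∑ k ∈ Finset.range n, ∑ j ∈ crossed ξ k, ∫⁻ x, ‖f x‖ₑ ∂ν := by
        rw [lintegral_finsetSum _ fun k _ => Finset.measurable_sum _ fun j _ => hm j]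
        refine Finset.sum_congr rfl fun k _ => ?_
        rw [lintegral_finsetSum _ fun j _ => hm j]
        exact Finset.sum_congr rfl fun j _ =>
          (measurePreserving_gap ν j).lintegral_comp hf.enorm
    _ = _ := by simp only [Finset.sum_const, card_crossed, nsmul_eq_mul, Finset.sum_mul]

end Gaps

section Joint

/-- The joint law of gaps and jumps. -/
noncomputable def jointLaw (ν : Measure ℝ) (p : PMF ℤ) : Measure ((ℤ → ℝ) × (ℕ → ℤ)) :=
  (gapLaw ν).prod (walkLaw p)

theorem ae_jointLaw_fst {ν : Measure ℝ} {p : PMF ℤ} {q : (ℤ → ℝ) → Prop} (h : ∀ᵐ ζ ∂(gapLaw ν), q ζ) :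
    ∀ᵐ z ∂(jointLaw ν p), q z.1 := by
  unfold jointLaw
  exact Measure.quasiMeasurePreserving_fst.ae h

theorem measurePreserving_fst_jointLaw {ν : Measure ℝ} {p : PMF ℤ} :
    MeasurePreserving Prod.fst (jointLaw ν p) (gapLaw ν) := by
  unfold jointLaw
  exact measurePreserving_fst

variable (ν : Measure ℝ) [IsProbabilityMeasure ν] (p : PMF ℤ)

instance : IsProbabilityMeasure (jointLaw ν p) := by unfold jointLaw; infer_instance

variable {ν p}

theorem measure_le_abs_crossingSum_of_bounded
    (hL : MemLp (fun k : ℤ => (k : ℝ)) 2 p.toMeasure) {f : ℝ → ℝ}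
    (hf : Measurable f) (h0 : ∫ x, f x ∂ν = 0) {B : ℝ} (hB : ∀ x, |f x| ≤ B) {r : ℝ} (hr : 0 < r)
    (n : ℕ) :
    jointLaw ν p {z | r ≤ |crossingSum f n z|} ≤
      ENNReal.ofReal (B ^ 2 * (n * (meanAbsJump p + 2 * (meanAbsJump p ^ 2 *
        ∑ m ∈ Finset.range n, concentration p m))) / r ^ 2) := by
  have hm : Measurable fun z => ENNReal.ofReal (crossingSum f n z ^ 2) :=
    ((measurable_crossingSum hf n).pow_const 2).ennreal_ofReal
  have hsub : {z | r ≤ |crossingSum f n z|} ⊆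
      {z | ENNReal.ofReal (r ^ 2) ≤ ENNReal.ofReal (crossingSum f n z ^ 2)} := fun z hz => by
    refine ENNReal.ofReal_le_ofReal ?_
    rw [← sq_abs (crossingSum f n z)]
    exact pow_le_pow_left₀ hr.le hz 2
  have hr2 : 0 < r ^ 2 := by positivity
  refine (measure_mono hsub).trans ((meas_ge_le_lintegral_div hm.aemeasurable
    (by simpa using hr.ne') ENNReal.ofReal_ne_top).trans ?_)
  rw [ENNReal.ofReal_div_of_pos hr2]
  refine ENNReal.div_le_div_right ?_ _
  rw [jointLaw, lintegral_prod_symm _ hm.aemeasurable]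
  refine (lintegral_mono fun ξ => lintegral_sq_crossingSum_le hf h0 hB n ξ).trans ?_
  rw [lintegral_const_mul _ (measurable_crossingPairs n), ENNReal.ofReal_mul (sq_nonneg _)]
  exact mul_le_mul_right (lintegral_crossingPairs_le hL n) _

theorem measure_le_abs_crossingSum (hL : MemLp (fun k : ℤ => (k : ℝ)) 2 p.toMeasure) {f : ℝ → ℝ}
    (hf : Measurable f) (hi : Integrable f ν) {r : ℝ} (hr : 0 < r) (n : ℕ) :
    jointLaw ν p {z | r ≤ |crossingSum f n z|} ≤
      ENNReal.ofReal (n * meanAbsJump p * (∫ x, |f x| ∂ν) / r) := by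
  have hm := (measurable_crossingSum hf n).enorm
  have hsub : {z | r ≤ |crossingSum f n z|} ⊆
      {z | ENNReal.ofReal r ≤ ‖crossingSum f n z‖ₑ} := fun z hz => by
    rw [Set.mem_ofPred_eq, Real.enorm_eq_ofReal_abs]
    exact ENNReal.ofReal_le_ofReal hz
  have hm0 : 0 ≤ meanAbsJump p := by
    rw [meanAbsJump_eq hL]; exact integral_nonneg fun k => abs_nonneg _
  have hk : ∀ k, Measurable fun ξ : ℕ → ℤ => ((ξ k).natAbs : ℝ≥0∞) := fun k =>
    (measurable_of_countable fun a : ℤ => (a.natAbs : ℝ≥0∞)).comp (measurable_pi_apply k)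
  refine (measure_mono hsub).trans ((meas_ge_le_lintegral_div hm.aemeasurable
    (by simpa using hr) ENNReal.ofReal_ne_top).trans ?_)
  rw [ENNReal.ofReal_div_of_pos hr]
  refine ENNReal.div_le_div_right ?_ _
  rw [jointLaw, lintegral_prod_symm _ hm.aemeasurable]
  refine (lintegral_mono fun ξ => lintegral_abs_crossingSum_le hf n ξ).trans (le_of_eq ?_)
  rw [lintegral_mul_const _ (Finset.measurable_sum _ fun k _ => hk k),
    lintegral_finsetSum _ fun k _ => hk k]
  simp only [lintegral_natAbs_jump hL, Finset.sum_const, Finset.card_range, nsmul_eq_mul]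
  rw [ENNReal.ofReal_mul (by positivity), ENNReal.ofReal_mul (by positivity),
    ENNReal.ofReal_natCast, ← ofReal_integral_norm_eq_lintegral_enorm hi]
  rfl

/-- The weak law of large numbers for the gaps crossed by the walk. -/
theorem tendsto_measure_le_abs_crossingSum (hp_symm : ∀ k : ℤ, p (-k) = p k)
    (hL : MemLp (fun k : ℤ => (k : ℝ)) 2 p.toMeasure) (h1 : p 1 ≠ 0) {f : ℝ → ℝ}
    (hf : Measurable f) (hi : Integrable f ν) (h0 : ∫ x, f x ∂ν = 0) {ε : ℝ} (hε : 0 < ε) :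
    Tendsto (fun n : ℕ => jointLaw ν p {z | ε * n ≤ |crossingSum f n z|}) atTop (𝓝 0) := by
  have hm0 := meanAbsJump_pos hL h1
  rw [ENNReal.tendsto_nhds_zero]
  intro δ hδ
  obtain ⟨η, hη, hηδ⟩ : ∃ η : ℝ, 0 < η ∧ ENNReal.ofReal η ≤ δ := by
    rcases eq_or_ne δ ⊤ with rfl | h
    · exact ⟨1, one_pos, le_top⟩
    · exact ⟨δ.toReal, ENNReal.toReal_pos hδ.ne' h, ENNReal.ofReal_toReal_le⟩
  have hcut := tendsto_integral_abs_sub_cutoff_pow hi.aestronglyMeasurable one_ne_zero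
    (by simpa using hi.abs)
  simp only [pow_one] at hcut
  obtain ⟨K, hK, hK0⟩ : ∃ K : ℝ, ∫ x, |f x - cutoff K (f x)| ∂ν <
      η * ε / (8 * meanAbsJump p) ∧ 0 < K :=
    ((hcut.eventually_lt_const (by positivity)).and (eventually_gt_atTop 0)).exists
  have hgm : Measurable fun x => cutoff K (f x) := (measurable_cutoff K).comp hf
  have hgi : Integrable (fun x => cutoff K (f x)) ν :=
    Integrable.of_bound hgm.aestronglyMeasurable K
      (Eventually.of_forall fun x => abs_cutoff_le hK0.le _)
  set c : ℝ := ∫ x, cutoff K (f x) ∂ν with hc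
  have hcK : |c| ≤ K := by
    have := norm_integral_le_of_norm_le_const (μ := ν) (f := fun x => cutoff K (f x)) (C := K)
      (Eventually.of_forall fun x => abs_cutoff_le hK0.le _)
    simpa using this
  have hg0 : ∫ x, (cutoff K (f x) - c) ∂ν = 0 := by
    rw [integral_sub hgi (integrable_const _)]; simp [hc]
  have hgB : ∀ x, |cutoff K (f x) - c| ≤ 2 * K := fun x =>
    (abs_sub _ _).trans (by linarith [abs_cutoff_le hK0.le (f x)])
  have hcle : |c| ≤ ∫ x, |f x - cutoff K (f x)| ∂ν := by
    have : c = -∫ x, (f x - cutoff K (f x)) ∂ν := by rw [integral_sub hi hgi, h0, hc]; ring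
    rw [this, abs_neg]
    exact abs_integral_le_integral_abs
  have hhi : Integrable (fun x => f x - cutoff K (f x)) ν := hi.sub hgi
  have hh : ∫ x, |f x - (cutoff K (f x) - c)| ∂ν ≤ η * ε / (4 * meanAbsJump p) := by
    calc ∫ x, |f x - (cutoff K (f x) - c)| ∂ν
        ≤ ∫ x, (|f x - cutoff K (f x)| + |c|) ∂ν := by
          refine integral_mono (hi.sub (hgi.sub (integrable_const _))).abs
            (hhi.abs.fun_add (integrable_const _)) fun x => ?_
          simp only [sub_sub_eq_add_sub, add_sub_right_comm]
          exact abs_add_le _ _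
      _ = (∫ x, |f x - cutoff K (f x)| ∂ν) + |c| := by
          rw [integral_add hhi.abs (integrable_const _)]; simp
      _ ≤ η * ε / (8 * meanAbsJump p) + η * ε / (8 * meanAbsJump p) :=
          add_le_add hK.le (hcle.trans hK.le)
      _ = η * ε / (4 * meanAbsJump p) := by field_simp; ring
  have hb := ((tendsto_crossingPairs_bound hp_symm h1).const_mul
    ((2 * K) ^ 2 / (ε / 2) ^ 2)).eventually_le_const (u := η / 2) (by simpa using hη)
  filter_upwards [hb, eventually_gt_atTop 0] with n hn hn0
  have hn0' : (0 : ℝ) < n := by exact_mod_cast hn0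
  have hsub : {z | ε * n ≤ |crossingSum f n z|} ⊆
      {z | ε / 2 * n ≤ |crossingSum (fun x => cutoff K (f x) - c) n z|} ∪
      {z | ε / 2 * n ≤ |crossingSum (fun x => f x - (cutoff K (f x) - c)) n z|} := fun z hz => by
    have e : crossingSum f n z = crossingSum (fun x => cutoff K (f x) - c) n z +
        crossingSum (fun x => f x - (cutoff K (f x) - c)) n z := by
      simp only [crossingSum, ← Finset.sum_add_distrib, add_sub_cancel]
    by_contra hcon
    simp only [Set.mem_union, Set.mem_ofPred_eq, not_or, not_le] at hcon hz
    rw [e] at hz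
    linarith [abs_add_le (crossingSum (fun x => cutoff K (f x) - c) n z)
      (crossingSum (fun x => f x - (cutoff K (f x) - c)) n z)]
  refine (measure_mono hsub).trans ((measure_union_le _ _).trans ?_)
  refine (add_le_add
    (measure_le_abs_crossingSum_of_bounded hL (hgm.sub_const c) hg0 hgB (by positivity) n)
    (measure_le_abs_crossingSum hL (hf.sub (hgm.sub_const c))
      (hi.sub (hgi.sub (integrable_const _))) (by positivity) n)).trans ?_
  have hη2 : ENNReal.ofReal η = ENNReal.ofReal (η / 2) + ENNReal.ofReal (η / 2) := by
    rw [← ENNReal.ofReal_add (by positivity) (by positivity), add_halves]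
  refine le_trans ?_ hηδ
  rw [hη2]
  refine add_le_add (ENNReal.ofReal_le_ofReal ?_) (ENNReal.ofReal_le_ofReal ?_)
  · refine le_trans (le_of_eq ?_) hn
    field_simp
  · rw [div_le_iff₀ (by positivity)]
    calc _ ≤ n * meanAbsJump p * (η * ε / (4 * meanAbsJump p)) := by gcongr; exact hh
      _ = η / 2 * (ε / 2 * n) := by field_simp; ring

theorem targets_sub_targets (ζ : ℤ → ℝ) {x y : ℤ} (h : x ≤ y) :
    targets ζ y - targets ζ x = ∑ j ∈ Finset.Ioc x y, ζ j := by
  induction y, h using Int.leInduction with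
  | base => simp
  | succ y hy ih =>
    have : Finset.Ioc x (y + 1) = insert (y + 1) (Finset.Ioc x y) := by
      ext j; simp only [Finset.mem_Ioc, Finset.mem_insert]; omega
    rw [this, Finset.sum_insert (by simp), ← ih, targets_rec ζ (y + 1), add_sub_cancel_right]
    ring

theorem abs_targets_sub_targets {ζ : ℤ → ℝ} (hζ : ∀ j, 0 < ζ j) (x y : ℤ) :
    |targets ζ y - targets ζ x| = ∑ j ∈ edges x y, ζ j := by
  rcases le_total x y with h | h
  · rw [edges, min_eq_left h, max_eq_right h, targets_sub_targets ζ h]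
    exact abs_of_nonneg (Finset.sum_nonneg fun j _ => (hζ j).le)
  · rw [edges, min_eq_right h, max_eq_left h, abs_sub_comm, targets_sub_targets ζ h]
    exact abs_of_nonneg (Finset.sum_nonneg fun j _ => (hζ j).le)

theorem collisionTime_targets {ζ : ℤ → ℝ} (hζ : ∀ j, 0 < ζ j) (ξ : ℕ → ℤ) (n : ℕ) (m : ℝ) :
    collisionTime (targets ζ) ξ n = crossingSum (fun x => x - m) n (ζ, ξ) +
      m * ∑ k ∈ Finset.range n, |(ξ k : ℝ)| := by
  rw [collisionTime, crossingSum, Finset.mul_sum, ← Finset.sum_add_distrib]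
  refine Finset.sum_congr rfl fun k _ => ?_
  rw [abs_targets_sub_targets hζ, Finset.sum_sub_distrib, Finset.sum_const, card_crossed,
    nsmul_eq_mul, Nat.cast_natAbs, Int.cast_abs, crossed]
  ring

theorem ae_gap_pos (hν_pos : ∀ᵐ x ∂ν, 0 < x) : ∀ᵐ ζ ∂(gapLaw ν), ∀ j, 0 < ζ j :=
  ae_all_iff.mpr fun j => (measurePreserving_gap ν j).quasiMeasurePreserving.ae hν_pos

theorem measurePreserving_snd_jointLaw :
    MeasurePreserving Prod.snd (jointLaw ν p) (walkLaw p) := by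
  unfold jointLaw
  exact measurePreserving_snd

theorem tendsto_measure_le_abs_sum_abs_jump
    (hL : MemLp (fun k : ℤ => (k : ℝ)) 2 p.toMeasure) {ε : ℝ} (hε : 0 < ε) :
    Tendsto (fun n : ℕ => walkLaw p {ξ | ε * n ≤
      |∑ k ∈ Finset.range n, (|(ξ k : ℝ)| - meanAbsJump p)|}) atTop (𝓝 0) := by
  have hL' : MemLp (fun k : ℤ => |(k : ℝ)| - meanAbsJump p) 2 p.toMeasure :=
    hL.abs.sub (memLp_const _)
  set v := ∫ k : ℤ, (|(k : ℝ)| - meanAbsJump p) ^ 2 ∂p.toMeasure with hv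
  have h0 : ∫ k : ℤ, (|(k : ℝ)| - meanAbsJump p) ∂p.toMeasure = 0 := by
    rw [integral_sub (hL.integrable one_le_two).abs (integrable_const _), meanAbsJump_eq hL]
    simp
  have hlim : Tendsto (fun n : ℕ => ENNReal.ofReal (v / ε ^ 2 / n)) atTop (𝓝 0) := by
    have := ENNReal.tendsto_ofReal (tendsto_const_div_atTop_nhds_zero_nat (v / ε ^ 2))
    rwa [ENNReal.ofReal_zero] at this
  refine tendsto_of_tendsto_of_tendsto_of_le_of_le' tendsto_const_nhds hlim
    (Eventually.of_forall fun n => bot_le) ?_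
  filter_upwards [eventually_gt_atTop 0] with n hn
  have hn0 : (0 : ℝ) < n := by exact_mod_cast hn
  have hK := measure_exists_le_abs_sum
    (iIndepFun_comp_jump p (f := fun k : ℤ => |(k : ℝ)| - meanAbsJump p))
    (fun i => (measurable_of_countable fun k : ℤ => |(k : ℝ)| - meanAbsJump p).comp
      (measurable_pi_apply i)) (memLp_comp_jump p hL')
    (fun i => (integral_comp_jump p (fun k : ℤ => |(k : ℝ)| - meanAbsJump p) i).trans h0)
    (fun i => integral_comp_jump p (fun k : ℤ => (|(k : ℝ)| - meanAbsJump p) ^ 2) i) n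
    (r := ε * n) (by positivity)
  refine (measure_mono fun ξ hξ => ?_).trans (hK.trans (ENNReal.ofReal_le_ofReal (le_of_eq ?_)))
  · exact ⟨n, le_rfl, hξ⟩
  · rw [← hv]; field_simp

/-- The weak law of large numbers for the collision times. -/
theorem tendsto_measure_le_abs_collisionTime (hν_pos : ∀ᵐ x ∂ν, 0 < x)
    (hν_int : Integrable (fun x : ℝ => x) ν) (hp_symm : ∀ k : ℤ, p (-k) = p k)
    (hL : MemLp (fun k : ℤ => (k : ℝ)) 2 p.toMeasure) (h1 : p 1 ≠ 0) {ε : ℝ} (hε : 0 < ε) :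
    Tendsto (fun n : ℕ => jointLaw ν p {z | ε * n ≤
      |collisionTime (targets z.1) z.2 n - (∫ x, x ∂ν) * meanAbsJump p * n|}) atTop (𝓝 0) := by
  set m := ∫ x, x ∂ν with hm
  have hm0 : 0 ≤ m := integral_nonneg_of_ae (hν_pos.mono fun x hx => hx.le)
  have hA := tendsto_measure_le_abs_crossingSum (ν := ν) (p := p) hp_symm hL h1
    (f := fun x => x - m) (by fun_prop) (hν_int.sub (integrable_const _))
    (by rw [integral_sub hν_int (integrable_const _)]; simp [hm]) (half_pos hε)
  have hB := tendsto_measure_le_abs_sum_abs_jump hL (p := p) (ε := ε / 2 / (m + 1)) (by positivity)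
  have hAB := hA.add hB
  rw [add_zero] at hAB
  refine tendsto_of_tendsto_of_tendsto_of_le_of_le tendsto_const_nhds hAB (fun n => bot_le)
    fun n => ?_
  have hmB : MeasurableSet {ξ : ℕ → ℤ | ε / 2 / (m + 1) * n ≤
      |∑ k ∈ Finset.range n, (|(ξ k : ℝ)| - meanAbsJump p)|} := by
    refine measurableSet_le measurable_const (continuous_abs.measurable.comp ?_)
    exact Finset.measurable_sum _ fun k _ =>
      (measurable_of_countable fun a : ℤ => |(a : ℝ)| - meanAbsJump p).comp (measurable_pi_apply k)
  simp only
  rw [← (measurePreserving_snd_jointLaw (ν := ν) (p := p)).measure_preimage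
    hmB.nullMeasurableSet]
  refine le_trans (measure_mono_ae ?_) (measure_union_le _ _)
  filter_upwards [ae_jointLaw_fst (p := p) (ae_gap_pos hν_pos)] with z hz hzs
  by_contra hcon
  have hcon' : ¬ (ε / 2 * n ≤ |crossingSum (fun x => x - m) n z| ∨
    ε / 2 / (m + 1) * n ≤ |∑ k ∈ Finset.range n, (|(z.2 k : ℝ)| - meanAbsJump p)|) := hcon
  have hzs' : ε * n ≤ |collisionTime (targets z.1) z.2 n - m * meanAbsJump p * n| := hzs
  rw [not_or, not_le, not_le] at hcon'
  obtain ⟨hc1, hc2⟩ := hcon'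
  rw [collisionTime_targets hz z.2 n m] at hzs'
  have e : crossingSum (fun x => x - m) n (z.1, z.2) + m * ∑ k ∈ Finset.range n, |(z.2 k : ℝ)| -
      m * meanAbsJump p * n = crossingSum (fun x => x - m) n z +
        m * ∑ k ∈ Finset.range n, (|(z.2 k : ℝ)| - meanAbsJump p) := by
    simp only [Finset.sum_sub_distrib, Finset.sum_const, Finset.card_range, nsmul_eq_mul]; ring
  rw [e] at hzs'
  have h2 : |m * ∑ k ∈ Finset.range n, (|(z.2 k : ℝ)| - meanAbsJump p)| ≤ ε / 2 * n := by
    rw [abs_mul, abs_of_nonneg hm0]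
    calc _ ≤ (m + 1) * (ε / 2 / (m + 1) * n) := by gcongr; linarith
      _ = ε / 2 * n := by field_simp
  linarith [abs_add_le (crossingSum (fun x => x - m) n z)
    (m * ∑ k ∈ Finset.range n, (|(z.2 k : ℝ)| - meanAbsJump p))]

end Joint

/-! ### Linear growth of the targets -/

theorem exists_forall_abs_sub_le_of_tendsto_div {u : ℕ → ℝ} {m : ℝ}
    (h : Tendsto (fun n : ℕ => u n / n) atTop (𝓝 m)) {ε : ℝ} (hε : 0 < ε) :
    ∃ C : ℝ, ∀ n : ℕ, |u n - m * n| ≤ ε * n + C := by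
  obtain ⟨N, hN⟩ := Metric.tendsto_atTop.mp h ε hε
  refine ⟨|u 0| + ∑ n ∈ Finset.range N, |u n - m * n|, fun n => ?_⟩
  have hs : 0 ≤ ∑ n ∈ Finset.range N, |u n - m * n| := Finset.sum_nonneg fun _ _ => abs_nonneg _
  rcases lt_or_ge n N with hn | hn
  · have := Finset.single_le_sum (f := fun n : ℕ => |u n - m * n|)
      (fun _ _ => abs_nonneg _) (Finset.mem_range.mpr hn)
    have : 0 ≤ ε * n := by positivity
    linarith [abs_nonneg (u 0)]
  · rcases Nat.eq_zero_or_pos n with rfl | hn0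
    · simpa using hs
    · have hn0' : (0 : ℝ) < n := by exact_mod_cast hn0
      have h2 := (hN n hn).le
      rw [Real.dist_eq, div_sub' hn0'.ne', abs_div, abs_of_pos hn0', div_le_iff₀ hn0',
        mul_comm (n : ℝ)] at h2
      linarith [abs_nonneg (u 0)]

theorem targets_natCast (ζ : ℤ → ℝ) (n : ℕ) :
    targets ζ n = ∑ i ∈ Finset.range n, ζ ((i : ℤ) + 1) := by
  induction n with
  | zero => simp [targets_zero]
  | succ n ih =>
    rw [Finset.sum_range_succ, ← ih, targets_rec ζ ((n + 1 : ℕ) : ℤ)]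
    push_cast
    rw [add_sub_cancel_right]

theorem targets_neg_natCast (ζ : ℤ → ℝ) (n : ℕ) :
    targets ζ (-(n : ℤ)) = -∑ i ∈ Finset.range n, ζ (-(i : ℤ)) := by
  induction n with
  | zero => simp [targets_zero]
  | succ n ih =>
    rw [Finset.sum_range_succ, neg_add, ← ih, targets_rec ζ (-(n : ℤ))]
    push_cast
    rw [neg_add, ← sub_eq_add_neg]
    ring

variable {ν : Measure ℝ} [IsProbabilityMeasure ν]

theorem ae_tendsto_sum_gap_div (hν_int : Integrable (fun x : ℝ => x) ν) {g : ℕ → ℤ}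
    (hg : Function.Injective g) :
    ∀ᵐ ζ ∂(gapLaw ν), Tendsto (fun n : ℕ => (∑ i ∈ Finset.range n, ζ (g i)) / (n : ℝ)) atTop
      (𝓝 (∫ x, x ∂ν)) := by
  have hid : ∀ i, IdentDistrib (fun ζ : ℤ → ℝ => ζ (g i)) (fun ζ => ζ (g 0))
      (gapLaw ν) (gapLaw ν) := fun i =>
    ⟨(measurable_pi_apply _).aemeasurable, (measurable_pi_apply _).aemeasurable, by
      rw [(measurePreserving_gap ν (g i)).map_eq, (measurePreserving_gap ν (g 0)).map_eq]⟩
  have h := strong_law_ae_real (μ := gapLaw ν) (fun (i : ℕ) (ζ : ℤ → ℝ) => ζ (g i))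
    ((measurePreserving_gap ν (g 0)).integrable_comp_of_integrable hν_int)
    (fun i j hij => (iIndepFun_comp_gap ν measurable_id).indepFun (hg.ne hij)) hid
  rwa [integral_comp_gap ν measurable_id' (g 0)] at h

theorem ae_exists_forall_abs_targets_sub_le (hν_int : Integrable (fun x : ℝ => x) ν) {ε : ℝ}
    (hε : 0 < ε) :
    ∀ᵐ ζ ∂(gapLaw ν), ∃ C : ℝ, ∀ j : ℤ,
      |targets ζ j - (∫ x, x ∂ν) * j| ≤ ε * |(j : ℝ)| + C := by
  filter_upwards [ae_tendsto_sum_gap_div hν_int (g := fun i => (i : ℤ) + 1)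
      (fun i j h => by simpa using h),
    ae_tendsto_sum_gap_div hν_int (g := fun i => -(i : ℤ)) (fun i j h => by simpa using h)]
    with ζ h₁ h₂
  obtain ⟨C₁, hC₁⟩ := exists_forall_abs_sub_le_of_tendsto_div h₁ hε
  obtain ⟨C₂, hC₂⟩ := exists_forall_abs_sub_le_of_tendsto_div h₂ hε
  refine ⟨max C₁ C₂, fun j => ?_⟩
  obtain ⟨n, rfl | rfl⟩ := j.eq_nat_or_neg
  · rw [targets_natCast, Int.cast_natCast, Nat.abs_cast]
    exact (hC₁ n).trans (by gcongr; exact le_max_left _ _)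
  · rw [targets_neg_natCast, Int.cast_neg, Int.cast_natCast, abs_neg, Nat.abs_cast, mul_neg,
      ← neg_sub', abs_neg]
    exact (hC₂ n).trans (by gcongr; exact le_max_right _ _)

theorem exists_measure_targets_le (hν_int : Integrable (fun x : ℝ => x) ν) {ε : ℝ}
    (hε : 0 < ε) {δ : ℝ≥0∞} (hδ : 0 < δ) :
    ∃ R : ℝ, gapLaw ν {ζ | ∃ j : ℤ,
      ε * |(j : ℝ)| + R < |targets ζ j - (∫ x, x ∂ν) * j|} ≤ δ := by
  set B : ℕ → Set (ℤ → ℝ) := fun R => {ζ | ∃ j : ℤ,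
    ε * |(j : ℝ)| + R < |targets ζ j - (∫ x, x ∂ν) * j|} with hB
  have hm : ∀ R, MeasurableSet (B R) := fun R => by
    simp only [hB, Set.ofPred_exists]
    refine MeasurableSet.iUnion fun j => measurableSet_lt measurable_const ?_
    exact continuous_abs.measurable.comp
      (((measurable_pi_apply j).comp measurable_targets).sub_const _)
  have hanti : Antitone B := fun R S hRS ζ ⟨j, hj⟩ =>
    ⟨j, lt_of_le_of_lt (by gcongr) hj⟩
  have hzero : gapLaw ν (⋂ R, B R) = 0 := by
    refine measure_mono_null (t := {ζ | ¬ ∃ C : ℝ, ∀ j : ℤ,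
      |targets ζ j - (∫ x, x ∂ν) * j| ≤ ε * |(j : ℝ)| + C}) ?_
      (ae_iff.mp (ae_exists_forall_abs_targets_sub_le hν_int hε))
    rintro ζ hζ ⟨C, hC⟩
    obtain ⟨R, hR⟩ := exists_nat_ge C
    obtain ⟨j, hj⟩ := Set.mem_iInter.mp hζ R
    linarith [hC j]
  have h := tendsto_measure_iInter_atTop (μ := gapLaw ν) (fun R => (hm R).nullMeasurableSet) hanti
    ⟨0, measure_ne_top _ _⟩
  rw [hzero] at h
  obtain ⟨R, hR⟩ := ((ENNReal.tendsto_nhds_zero.mp h) δ hδ).exists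
  exact ⟨R, hR⟩

/-! ### Approximation of the position by the walk -/

theorem abs_position_sub_le {ω : ℤ → ℝ} {ξ : ℕ → ℤ} {t : ℝ≥0} {a b : ℕ}
    (ha : collisionTime ω ξ a ≤ t) (hb : (t : ℝ) < collisionTime ω ξ b) {y r : ℝ}
    (hr : ∀ k, a ≤ k → k ≤ b → |ω (walk ξ k) - y| ≤ r) : |position ω ξ t - y| ≤ 3 * r := by
  classical
  have hex : ∃ m, (t : ℝ) < collisionTime ω ξ m := ⟨b, hb⟩
  obtain ⟨N, hN⟩ : ∃ N, Nat.find hex = N + 1 := Nat.exists_eq_succ_of_ne_zero fun h => by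
    have := Nat.find_spec hex
    rw [h] at this
    have h0 := (collisionTime_mono ω ξ (Nat.zero_le a)).trans ha
    linarith
  have h2 : (t : ℝ) < collisionTime ω ξ (N + 1) := hN ▸ Nat.find_spec hex
  have h1 : collisionTime ω ξ N ≤ t := not_lt.mp (Nat.find_min hex (by omega))
  have hNb : N + 1 ≤ b := hN ▸ Nat.find_min' hex hb
  have haN : a ≤ N := by
    by_contra hlt
    have := collisionTime_mono ω ξ (show N + 1 ≤ a by omega)
    linarith
  have hs : collisionTime ω ξ (N + 1) = collisionTime ω ξ N +
      |ω (walk ξ (N + 1)) - ω (walk ξ N)| := by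
    rw [collisionTime, collisionTime, Finset.sum_range_succ]
  have hsign : |((ξ N).sign : ℝ)| ≤ 1 := by
    rw [← Int.cast_abs]
    exact_mod_cast (by
      rcases Int.sign_trichotomy (ξ N) with h | h | h <;> rw [h] <;> norm_num :
        |(ξ N).sign| ≤ 1)
  rw [position_eq ω ξ t N h1 h2]
  have e : ω (walk ξ N) + ((ξ N).sign : ℝ) * (t - collisionTime ω ξ N) - y =
      (ω (walk ξ N) - y) + ((ξ N).sign : ℝ) * (t - collisionTime ω ξ N) := by ring
  have h3 : |((ξ N).sign : ℝ) * (t - collisionTime ω ξ N)| ≤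
      |ω (walk ξ (N + 1)) - ω (walk ξ N)| := by
    rw [abs_mul, abs_of_nonneg (sub_nonneg.mpr h1)]
    calc _ ≤ 1 * ((t : ℝ) - collisionTime ω ξ N) := by gcongr
      _ ≤ _ := by linarith
  have h4 : |ω (walk ξ (N + 1)) - ω (walk ξ N)| ≤ r + r := by
    have : ω (walk ξ (N + 1)) - ω (walk ξ N) =
      (ω (walk ξ (N + 1)) - y) - (ω (walk ξ N) - y) := by ring
    rw [this]
    exact (abs_sub _ _).trans (add_le_add (hr _ (by omega) hNb) (hr _ haN (by omega)))
  rw [e]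
  linarith [abs_add_le (ω (walk ξ N) - y) (((ξ N).sign : ℝ) * (t - collisionTime ω ξ N)),
    hr N haN (by omega)]

variable {p : PMF ℤ}

theorem measure_exists_le_abs_walk_sub (hp_symm : ∀ k : ℤ, p (-k) = p k)
    (hL : MemLp (fun k : ℤ => (k : ℝ)) 2 p.toMeasure) (a m : ℕ) {r : ℝ} (hr : 0 < r) :
    walkLaw p {ξ | ∃ k ≤ m, r ≤ |(walk ξ (a + k) : ℝ) - walk ξ a|} ≤
      ENNReal.ofReal (m * (∫ k : ℤ, (k : ℝ) ^ 2 ∂p.toMeasure) / r ^ 2) := by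
  have h := measure_exists_le_abs_sum
    ((iIndepFun_comp_jump p (f := fun k => (k : ℝ))).precomp (add_right_injective a))
    (fun i => (measurable_of_countable fun k : ℤ => (k : ℝ)).comp (measurable_pi_apply _))
    (fun i => memLp_comp_jump p hL _)
    (fun i => (integral_comp_jump p (fun k => (k : ℝ)) _).trans (integral_jump_eq_zero hp_symm))
    (fun i => integral_comp_jump p (fun k => (k : ℝ) ^ 2) _) m hr
  convert! h using 7 with ξ k
  rw [walk_cast, walk_cast, Finset.sum_range_add, add_sub_cancel_left]

theorem integral_gap_pos (hν_pos : ∀ᵐ x ∂ν, 0 < x) (hν_int : Integrable (fun x : ℝ => x) ν) :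
    0 < ∫ x, x ∂ν := by
  rw [integral_pos_iff_support_of_nonneg_ae (hν_pos.mono fun x hx => hx.le) hν_int]
  have : (Function.support fun x : ℝ => x) =ᵐ[ν] Set.univ := by
    filter_upwards [hν_pos] with x hx
    exact propext ⟨fun _ => trivial, fun _ => hx.ne'⟩
  rw [measure_congr this]
  simp

/-- At times close to the mean of the `n`-th collision time, the position is within `o(√n)` of a
multiple of the walk after `n` jumps, with high probability. -/
theorem exists_forall_measure_position_le (hν_pos : ∀ᵐ x ∂ν, 0 < x)
    (hν_int : Integrable (fun x : ℝ => x) ν) (hp_symm : ∀ k : ℤ, p (-k) = p k)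
    (hL : MemLp (fun k : ℤ => (k : ℝ)) 2 p.toMeasure) (h1 : p 1 ≠ 0) {η δ : ℝ} (hη : 0 < η)
    (hδ : 0 < δ) :
    ∃ N : ℕ, ∀ n ≥ N, ∀ t : ℝ≥0, (∫ x, x ∂ν) * meanAbsJump p * n ≤ t →
      (t : ℝ) < (∫ x, x ∂ν) * meanAbsJump p * (n + 1) →
      jointLaw ν p {z | η * √n < |position (targets z.1) z.2 t - (∫ x, x ∂ν) * walk z.2 n|} ≤
        ENNReal.ofReal δ := by
  have hm := integral_gap_pos hν_pos hν_int
  have hmb := meanAbsJump_pos hL h1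
  set m := ∫ x, x ∂ν with hmdef
  set κ := m * meanAbsJump p with hκ
  have hκ0 : 0 < κ := mul_pos hm hmb
  set v := ∫ k : ℤ, (k : ℝ) ^ 2 ∂p.toMeasure with hv
  have hv0 : 0 ≤ v := integral_nonneg fun k => sq_nonneg _
  set r : ℝ := η / (18 * m) with hr
  have hr0 : 0 < r := by positivity
  obtain ⟨q, hq2, hq⟩ : ∃ q : ℕ, 2 ≤ q ∧ 2 * v / r ^ 2 / q ≤ δ / 10 :=
    ((eventually_ge_atTop 2).and ((tendsto_const_div_atTop_nhds_zero_nat (2 * v / r ^ 2)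
      ).eventually_le_const (by positivity : (0 : ℝ) < δ / 10))).exists
  have hq0 : (0 : ℝ) < q := by exact_mod_cast (by omega : 0 < q)
  obtain ⟨b, hb1, hbv⟩ : ∃ b : ℝ, 0 < b ∧ v / b ^ 2 ≤ δ / 5 := by
    have h : Tendsto (fun b : ℝ => v / b ^ 2) atTop (𝓝 0) :=
      tendsto_const_nhds.div_atTop (tendsto_pow_atTop two_ne_zero)
    exact ((eventually_gt_atTop 0).and
      (h.eventually_le_const (by positivity : (0 : ℝ) < δ / 5))).exists
  set ε : ℝ := η / (9 * (b + 2 * r)) with hε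
  have hε0 : 0 < ε := by positivity
  obtain ⟨R, hR⟩ := exists_measure_targets_le (ν := ν) hν_int hε0
    (δ := ENNReal.ofReal (δ / 5)) (by simpa using hδ)
  have hτ := (ENNReal.tendsto_nhds_zero.mp (tendsto_measure_le_abs_collisionTime hν_pos hν_int
    hp_symm hL h1 (ε := κ / (3 * q)) (by positivity))) (ENNReal.ofReal (δ / 5)) (by simpa using hδ)
  obtain ⟨M, hM⟩ := eventually_atTop.mp hτ
  obtain ⟨N₁, hN₁⟩ : ∃ N : ℕ, ∀ n ≥ N, R ≤ η / 9 * √n := by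
    have h : Tendsto (fun n : ℕ => η / 9 * √(n : ℝ)) atTop atTop :=
      ((Real.tendsto_sqrt_atTop.comp tendsto_natCast_atTop_atTop).const_mul_atTop
        (by positivity))
    exact eventually_atTop.mp (h.eventually_ge_atTop R)
  obtain ⟨N₂, hN₂⟩ : ∃ N : ℕ, ∀ n ≥ N, 4 * v / r ^ 2 / (n : ℕ) ≤ δ / 10 :=
    eventually_atTop.mp ((tendsto_const_div_atTop_nhds_zero_nat (4 * v / r ^ 2)
      ).eventually_le_const (by positivity))
  refine ⟨max (2 * M + 4) (max N₁ N₂), fun n hn t ht₁ ht₂ => ?_⟩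
  have hnM : 2 * M + 4 ≤ n := le_trans (le_max_left _ _) hn
  have hnR := hN₁ n (le_trans ((le_max_left _ _).trans (le_max_right _ _)) hn)
  have hnv := hN₂ n (le_trans ((le_max_right _ _).trans (le_max_right _ _)) hn)
  have hn0 : (0 : ℝ) < n := by exact_mod_cast (by omega : 0 < n)
  have hnq2 : n / q ≤ n / 2 := Nat.div_le_div_left hq2 (by norm_num)
  have hnq_le : ((n / q : ℕ) : ℝ) ≤ n / q := Nat.cast_div_le
  have hnq_gt : (n : ℝ) / q < (n / q : ℕ) + 1 := by
    rw [div_lt_iff₀ hq0]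
    exact_mod_cast (Nat.lt_mul_div_succ n (by omega)).trans_eq (mul_comm _ _)
  obtain ⟨d, hd⟩ : ∃ d, d = n / q + 2 := ⟨_, rfl⟩
  have hdr : (d : ℝ) = (n / q : ℕ) + 2 := by rw [hd]; push_cast; rfl
  have hdn : d ≤ n := by omega
  set A := n - d with hA
  set B := n + d with hB
  have hAr : (A : ℝ) = n - d := by rw [hA, Nat.cast_sub hdn]
  have hBr : (B : ℝ) = n + d := by rw [hB, Nat.cast_add]
  have hBn : (B : ℝ) ≤ 3 * n := by exact_mod_cast (by omega : B ≤ 3 * n)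
  have hAn : (A : ℝ) ≤ 3 * n := by exact_mod_cast (by omega : A ≤ 3 * n)
  have hs0 : 0 < √(n : ℝ) := Real.sqrt_pos.mpr hn0
  have hss : √(n : ℝ) ^ 2 = n := Real.sq_sqrt hn0.le
  set E₁ := {z : (ℤ → ℝ) × (ℕ → ℤ) | κ / (3 * q) * A ≤ |collisionTime (targets z.1) z.2 A - κ * A|}
    with hE₁
  set E₂ := {z : (ℤ → ℝ) × (ℕ → ℤ) | κ / (3 * q) * B ≤ |collisionTime (targets z.1) z.2 B - κ * B|}
    with hE₂
  set E₃ := {ξ : ℕ → ℤ | ∃ k ≤ 2 * d, r * √n ≤ |(walk ξ (A + k) : ℝ) - walk ξ A|} with hE₃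
  set E₄ := {ξ : ℕ → ℤ | ∃ k ≤ n, b * √n ≤ |(walk ξ (0 + k) : ℝ) - walk ξ 0|} with hE₄
  set E₅ := {ζ : ℤ → ℝ | ∃ j : ℤ, ε * |(j : ℝ)| + R < |targets ζ j - m * j|} with hE₅
  have hsub : {z : (ℤ → ℝ) × (ℕ → ℤ) |
      η * √n < |position (targets z.1) z.2 t - m * walk z.2 n|} ⊆
      ((E₁ ∪ E₂) ∪ (Prod.snd ⁻¹' E₃ ∪ Prod.snd ⁻¹' E₄)) ∪ Prod.fst ⁻¹' E₅ := fun z hz => by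
    by_contra hcon
    simp only [Set.mem_union, Set.mem_preimage, not_or] at hcon
    obtain ⟨⟨⟨hz1, hz2⟩, hz3, hz4⟩, hz5⟩ := hcon
    simp only [hE₁, hE₂, hE₃, hE₄, hE₅, Set.mem_ofPred_eq, not_le, not_exists, not_and,
      not_lt, zero_add] at hz1 hz2 hz3 hz4 hz5
    have hcoef : ∀ x : ℝ, x ≤ 3 * n → κ / (3 * q) * x ≤ κ * (n / q) := fun x hx => by
      calc κ / (3 * q) * x ≤ κ / (3 * q) * (3 * n) := by gcongr
        _ = κ * (n / q) := by field_simp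
    have hta : collisionTime (targets z.1) z.2 A ≤ t := by
      have h1 := (abs_lt.mp (hz1.trans_le (hcoef _ hAn))).2
      rw [hAr] at h1
      have h2 : κ * (n / q) ≤ κ * d := by gcongr; linarith
      linarith
    have htb : (t : ℝ) < collisionTime (targets z.1) z.2 B := by
      have h1 := (abs_lt.mp (hz2.trans_le (hcoef _ hBn))).1
      rw [hBr] at h1
      have h2 : κ * (n / q) ≤ κ * (d - 1) := by gcongr; linarith
      linarith
    have hwA : ∀ k, A ≤ k → k ≤ B → |(walk z.2 k : ℝ) - walk z.2 A| ≤ r * √n := fun k hk1 hk2 => by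
      have := hz3 (k - A) (by omega)
      rw [Nat.add_sub_cancel' hk1] at this
      exact this.le
    have hwn := hwA n (by omega) (by omega)
    have hn4 : |(walk z.2 n : ℝ)| ≤ b * √n := by
      have := hz4 n le_rfl
      simpa [walk] using this.le
    have hkey := abs_position_sub_le hta htb (y := m * walk z.2 n) (r := η / 3 * √n)
      fun k hk1 hk2 => by
        have e : targets z.1 (walk z.2 k) - m * walk z.2 n =
          (targets z.1 (walk z.2 k) - m * walk z.2 k) +
            m * ((walk z.2 k : ℝ) - walk z.2 n) := by ring
        have hkn : |(walk z.2 k : ℝ) - walk z.2 n| ≤ 2 * r * √n := by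
          have e' : (walk z.2 k : ℝ) - walk z.2 n =
            ((walk z.2 k : ℝ) - walk z.2 A) - ((walk z.2 n : ℝ) - walk z.2 A) := by ring
          rw [e']
          linarith [abs_sub ((walk z.2 k : ℝ) - walk z.2 A) ((walk z.2 n : ℝ) - walk z.2 A),
            hwA k hk1 hk2]
        have hk : |(walk z.2 k : ℝ)| ≤ (b + 2 * r) * √n := by
          have e' : (walk z.2 k : ℝ) = ((walk z.2 k : ℝ) - walk z.2 n) + walk z.2 n := by ring
          rw [e']
          linarith [abs_add_le ((walk z.2 k : ℝ) - walk z.2 n) (walk z.2 n)]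
        have h5 := hz5 (walk z.2 k)
        have h6 : ε * |(walk z.2 k : ℝ)| ≤ η / 9 * √n := by
          calc ε * |(walk z.2 k : ℝ)| ≤ ε * ((b + 2 * r) * √n) := by gcongr
            _ = η / 9 * √n := by rw [hε]; field_simp
        have h7 : |m * ((walk z.2 k : ℝ) - walk z.2 n)| ≤ η / 9 * √n := by
          rw [abs_mul, abs_of_pos hm]
          calc m * |(walk z.2 k : ℝ) - walk z.2 n| ≤ m * (2 * r * √n) := by gcongr
            _ = η / 9 * √n := by rw [hr]; field_simp; ring
        rw [e]
        linarith [abs_add_le (targets z.1 (walk z.2 k) - m * walk z.2 k)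
          (m * ((walk z.2 k : ℝ) - walk z.2 n))]
    have hz' : η * √n < |position (targets z.1) z.2 t - m * walk z.2 n| := hz
    linarith
  have hmw : ∀ a k : ℕ, Measurable fun ξ : ℕ → ℤ => |(walk ξ (a + k) : ℝ) - walk ξ a| :=
    fun a k => continuous_abs.measurable.comp
      (((measurable_of_countable fun x : ℤ => (x : ℝ)).comp (measurable_walk _)).sub
        ((measurable_of_countable fun x : ℤ => (x : ℝ)).comp (measurable_walk _)))
  have hmex : ∀ (a l : ℕ) (s : ℝ), MeasurableSet
      {ξ : ℕ → ℤ | ∃ k ≤ l, s ≤ |(walk ξ (a + k) : ℝ) - walk ξ a|} := fun a l s => by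
    simp only [Set.ofPred_exists, Set.ofPred_and]
    exact MeasurableSet.iUnion fun k => (MeasurableSet.const _).inter
      (measurableSet_le measurable_const (hmw a k))
  have hmE₅ : MeasurableSet E₅ := by
    simp only [hE₅, Set.ofPred_exists]
    refine MeasurableSet.iUnion fun j => measurableSet_lt measurable_const ?_
    exact continuous_abs.measurable.comp
      (((measurable_pi_apply j).comp measurable_targets).sub_const _)
  have b₁ : jointLaw ν p E₁ ≤ ENNReal.ofReal (δ / 5) := hM A (by omega)
  have b₂ : jointLaw ν p E₂ ≤ ENNReal.ofReal (δ / 5) := hM B (by omega)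
  have b₃ : jointLaw ν p (Prod.snd ⁻¹' E₃) ≤ ENNReal.ofReal (δ / 5) := by
    rw [measurePreserving_snd_jointLaw.measure_preimage (hmex _ _ _).nullMeasurableSet]
    refine (measure_exists_le_abs_walk_sub hp_symm hL A (2 * d) (by positivity)).trans
      (ENNReal.ofReal_le_ofReal ?_)
    rw [← hv, mul_pow, hss]
    calc ((2 * d : ℕ) : ℝ) * v / (r ^ 2 * n) ≤ (2 * (n / q + 2)) * v / (r ^ 2 * n) := by
          push_cast
          gcongr
          linarith
      _ = 2 * v / r ^ 2 / q + 4 * v / r ^ 2 / n := by field_simp; ring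
      _ ≤ δ / 5 := by linarith
  have b₄ : jointLaw ν p (Prod.snd ⁻¹' E₄) ≤ ENNReal.ofReal (δ / 5) := by
    rw [measurePreserving_snd_jointLaw.measure_preimage (hmex _ _ _).nullMeasurableSet]
    refine (measure_exists_le_abs_walk_sub hp_symm hL 0 n (by positivity)).trans
      (ENNReal.ofReal_le_ofReal (le_trans (le_of_eq ?_) hbv))
    rw [← hv, mul_pow, hss]
    field_simp
  have b₅ : jointLaw ν p (Prod.fst ⁻¹' E₅) ≤ ENNReal.ofReal (δ / 5) := by
    rw [measurePreserving_fst_jointLaw.measure_preimage hmE₅.nullMeasurableSet]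
    exact hR
  calc _ ≤ _ := measure_mono hsub
    _ ≤ ((ENNReal.ofReal (δ / 5) + ENNReal.ofReal (δ / 5)) +
        (ENNReal.ofReal (δ / 5) + ENNReal.ofReal (δ / 5))) + ENNReal.ofReal (δ / 5) :=
      (measure_union_le _ _).trans (add_le_add ((measure_union_le _ _).trans
        (add_le_add ((measure_union_le _ _).trans (add_le_add b₁ b₂))
          ((measure_union_le _ _).trans (add_le_add b₃ b₄)))) b₅)
    _ = ENNReal.ofReal δ := by
      have h5 : 0 ≤ δ / 5 := by positivity
      rw [← ENNReal.ofReal_add h5 h5, ← ENNReal.ofReal_add (by positivity) (by positivity),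
        ← ENNReal.ofReal_add (by positivity) h5]
      congr 1
      ring

/-! ### The second moment -/

theorem iIndepFun_comp_measurePreserving {Ω Ω' ι β : Type*} [MeasurableSpace Ω]
    [MeasurableSpace Ω'] [MeasurableSpace β] {P : Measure Ω} {P' : Measure Ω'} {X : ι → Ω → β}
    {T : Ω' → Ω} (hi : iIndepFun X P) (hX : ∀ i, Measurable (X i)) (hT : MeasurePreserving T P' P) :
    iIndepFun (fun i ω => X i (T ω)) P' := by
  rw [iIndepFun_iff_measure_inter_preimage_eq_mul] at hi ⊢
  intro S sets hS
  have e : ∀ i, (fun ω => X i (T ω)) ⁻¹' sets i = T ⁻¹' (X i ⁻¹' sets i) := fun i => rfl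
  have hms : ∀ i ∈ S, MeasurableSet (X i ⁻¹' sets i) := fun i hiS => hX i (hS i hiS)
  simp only [e]
  rw [← Set.preimage_iInter₂, hT.measure_preimage
    (Finset.measurableSet_biInter S hms).nullMeasurableSet, hi S hS]
  exact Finset.prod_congr rfl fun i hiS =>
    (hT.measure_preimage (hms i hiS).nullMeasurableSet).symm

theorem exists_forall_setIntegral_sq_walk_le (hp_symm : ∀ k : ℤ, p (-k) = p k)
    (hL : MemLp (fun k : ℤ => (k : ℝ)) 2 p.toMeasure) {ε : ℝ} (hε : 0 < ε) :
    ∃ δ > 0, ∀ (n : ℕ) (A : Set ((ℤ → ℝ) × (ℕ → ℤ))), MeasurableSet A →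
      (jointLaw ν p).real A ≤ δ →
      ∫ z in A, (walk z.2 n : ℝ) ^ 2 ∂(jointLaw ν p) ≤ ε * n := by
  have hmX : ∀ i, Measurable fun ξ : ℕ → ℤ => (ξ i : ℝ) := fun i =>
    (measurable_of_countable fun k : ℤ => (k : ℝ)).comp (measurable_pi_apply i)
  have hT := measurePreserving_snd_jointLaw (ν := ν) (p := p)
  have hmY : ∀ i, Measurable fun z : (ℤ → ℝ) × (ℕ → ℤ) => (z.2 i : ℝ) := fun i =>
    (hmX i).comp measurable_snd
  have h := exists_forall_setIntegral_sq_sum_le (P := jointLaw ν p)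
    (X := fun i z => (z.2 i : ℝ))
    (iIndepFun_comp_measurePreserving (iIndepFun_comp_jump p (f := fun k => (k : ℝ))) hmX hT) hmY
    (fun i => ⟨(hmY i).aemeasurable, (hmY 0).aemeasurable, by
      have e : ∀ i, (jointLaw ν p).map (fun z => (z.2 i : ℝ)) =
          (walkLaw p).map fun ξ => (ξ i : ℝ) := fun i => by
        rw [← hT.map_eq, Measure.map_map (hmX i) measurable_snd]; rfl
      rw [e, e, (identDistrib_comp_jump p (fun k => (k : ℝ)) i).map_eq]⟩)
    ((memLp_comp_jump p hL 0).comp_measurePreserving hT)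
    (by
      have h0 := (integral_comp_jump p (fun k => (k : ℝ)) 0).trans (integral_jump_eq_zero hp_symm)
      rw [← hT.map_eq, integral_map measurable_snd.aemeasurable
        (hmX 0).aestronglyMeasurable] at h0
      exact h0) hε
  simpa only [walk_cast] using h

theorem lintegral_annealedLaw (t : ℝ≥0) :
    ∫⁻ z, ENNReal.ofReal (z.1 t ^ 2) ∂(annealedLaw ν p) =
      ∫⁻ z, ENNReal.ofReal (position (targets z.1) z.2 t ^ 2) ∂(jointLaw ν p) := by
  have hm : Measurable fun f : ℝ≥0 → ℝ => ENNReal.ofReal (f t ^ 2) :=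
    ((measurable_pi_apply t).pow_const 2).ennreal_ofReal
  have hpos : Measurable fun x : (ℤ → ℝ) × (ℕ → ℤ) => ENNReal.ofReal (position x.1 x.2 t ^ 2) :=
    hm.comp measurable_position
  have hT : Measurable fun z : (ℤ → ℝ) × (ℕ → ℤ) => (targets z.1, z.2) :=
    (measurable_targets.comp measurable_fst).prodMk measurable_snd
  have hfst : Measurable fun z : (ℝ≥0 → ℝ) × (ℤ → ℝ) => ENNReal.ofReal (z.1 t ^ 2) :=
    hm.comp measurable_fst
  have hsnd : Measurable fun z : (ℤ → ℝ) × (ℝ≥0 → ℝ) => ENNReal.ofReal (z.2 t ^ 2) :=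
    hm.comp measurable_snd
  have hposT : Measurable fun z : (ℤ → ℝ) × (ℕ → ℤ) =>
      ENNReal.ofReal (position (targets z.1) z.2 t ^ 2) := hpos.comp hT
  rw [annealedLaw, lintegral_map hfst measurable_swap]
  simp only [Prod.fst_swap]
  rw [Measure.lintegral_compProd hsnd, jointLaw, lintegral_prod _ hposT.aemeasurable]
  have e : ∀ ω : ℤ → ℝ, ∫⁻ f, ENNReal.ofReal (f t ^ 2) ∂(quenchedLaw p ω) =
      ∫⁻ ξ, ENNReal.ofReal (position ω ξ t ^ 2) ∂(walkLaw p) := fun ω =>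
    lintegral_map hm (measurable_position.comp (measurable_prodMk_left (x := ω)))
  simp only [e]
  rw [envLaw, lintegral_map hpos.lintegral_prod_right' measurable_targets]
  rfl

theorem ofReal_integral_le_lintegral {Ω : Type*} [MeasurableSpace Ω] {P : Measure Ω} {f : Ω → ℝ}
    {g : Ω → ℝ≥0∞} (hf : Integrable f P) (h : ∀ ω, ENNReal.ofReal (f ω) ≤ g ω) :
    ENNReal.ofReal (∫ ω, f ω ∂P) ≤ ∫⁻ ω, g ω ∂P := by
  have hle : ∫ ω, f ω ∂P ≤ ∫ ω, max (f ω) 0 ∂P :=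
    integral_mono hf hf.pos_part fun ω => le_max_left _ _
  refine (ENNReal.ofReal_le_ofReal hle).trans ?_
  rw [ofReal_integral_eq_lintegral_ofReal hf.pos_part
    (Eventually.of_forall fun ω => le_max_right _ _)]
  refine lintegral_mono fun ω => le_trans (le_of_eq ?_) (h ω)
  simp [ENNReal.ofReal_max]

theorem exists_forall_le_lintegral_position (hν_pos : ∀ᵐ x ∂ν, 0 < x)
    (hν_int : Integrable (fun x : ℝ => x) ν) (hp_symm : ∀ k : ℤ, p (-k) = p k)
    (hL : MemLp (fun k : ℤ => (k : ℝ)) 2 p.toMeasure) (h1 : p 1 ≠ 0) {ρ : ℝ} (hρ : 0 < ρ) :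
    ∃ N : ℕ, ∀ n ≥ N, ∀ t : ℝ≥0, (∫ x, x ∂ν) * meanAbsJump p * n ≤ t →
      (t : ℝ) < (∫ x, x ∂ν) * meanAbsJump p * (n + 1) →
      ENNReal.ofReal
        (n * ((∫ x, x ∂ν) ^ 2 * (∫ k : ℤ, (k : ℝ) ^ 2 ∂p.toMeasure) - ρ)) ≤
        ∫⁻ z, ENNReal.ofReal (position (targets z.1) z.2 t ^ 2) ∂(jointLaw ν p) := by
  have hm := integral_gap_pos hν_pos hν_int
  set m := ∫ x, x ∂ν with hmdef
  set v := ∫ k : ℤ, (k : ℝ) ^ 2 ∂p.toMeasure with hv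
  have hv0 : 0 ≤ v := integral_nonneg fun k => sq_nonneg _
  obtain ⟨δ, hδ, hUI⟩ := exists_forall_setIntegral_sq_walk_le (ν := ν) hp_symm hL
    (ε := ρ / (2 * m ^ 2)) (by positivity)
  set η : ℝ := ρ / (2 * m * (v + 1)) with hη
  obtain ⟨N, hN⟩ := exists_forall_measure_position_le hν_pos hν_int hp_symm hL h1
    (η := η) (by positivity) hδ
  refine ⟨N, fun n hn t ht₁ ht₂ => ?_⟩
  set A := {z : (ℤ → ℝ) × (ℕ → ℤ) | η * √n < |position (targets z.1) z.2 t - m * walk z.2 n|}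
    with hA
  have hη0 : 0 < η := by positivity
  have hmw : Measurable fun z : (ℤ → ℝ) × (ℕ → ℤ) => (walk z.2 n : ℝ) :=
    ((measurable_of_countable fun x : ℤ => (x : ℝ)).comp (measurable_walk n)).comp measurable_snd
  have hmp : Measurable fun z : (ℤ → ℝ) × (ℕ → ℤ) => position (targets z.1) z.2 t :=
    ((measurable_pi_apply t).comp measurable_position).comp
      ((measurable_targets.comp measurable_fst).prodMk measurable_snd)
  have hmA : MeasurableSet A := measurableSet_lt measurable_const
    (continuous_abs.measurable.comp (hmp.sub (hmw.const_mul m)))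
  have hPA : (jointLaw ν p).real A ≤ δ := by
    rw [measureReal_def]
    exact ENNReal.toReal_le_of_le_ofReal hδ.le (hN n hn t ht₁ ht₂)
  have hU := hUI n A hmA hPA
  have hT := measurePreserving_snd_jointLaw (ν := ν) (p := p)
  have hWL : MemLp (fun z : (ℤ → ℝ) × (ℕ → ℤ) => (walk z.2 n : ℝ)) 2 (jointLaw ν p) :=
    (memLp_walk hL n).comp_measurePreserving hT
  have hW2 : ∫ z, (walk z.2 n : ℝ) ^ 2 ∂(jointLaw ν p) = n * v := by
    rw [← integral_sq_walk hp_symm hL n, ← hT.map_eq,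
      integral_map measurable_snd.aemeasurable]
    exact (((measurable_of_countable fun x : ℤ => (x : ℝ)).comp
      (measurable_walk n)).pow_const 2).aestronglyMeasurable
  have hi := hWL.integrable_sq
  set f : (ℤ → ℝ) × (ℕ → ℤ) → ℝ := fun z => m ^ 2 * (walk z.2 n : ℝ) ^ 2 -
    (m ^ 2 * A.indicator (fun z => (walk z.2 n : ℝ) ^ 2) z +
      η * m * ((walk z.2 n : ℝ) ^ 2 + n)) with hf
  have hi1 := hi.const_mul (m ^ 2)
  have hi2 := (hi.indicator hmA).const_mul (m ^ 2)
  have hi3 := (hi.fun_add (integrable_const (n : ℝ))).const_mul (η * m)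
  have hfi : Integrable f (jointLaw ν p) := hi1.sub (hi2.add hi3)
  have hfint : n * (m ^ 2 * v - ρ) ≤ ∫ z, f z ∂(jointLaw ν p) := by
    simp only [hf]
    rw [integral_sub hi1 (hi2.fun_add hi3), integral_add hi2 hi3, integral_const_mul,
      integral_const_mul, integral_const_mul, integral_indicator hmA,
      integral_add hi (integrable_const _), hW2]
    simp only [integral_const, probReal_univ, one_smul]
    have h1 : m ^ 2 * ∫ z in A, (walk z.2 n : ℝ) ^ 2 ∂(jointLaw ν p) ≤ ρ / 2 * n := by
      calc _ ≤ m ^ 2 * (ρ / (2 * m ^ 2) * n) := by gcongr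
        _ = ρ / 2 * n := by field_simp
    have h2 : η * m * (n * v + n) = ρ / 2 * n := by rw [hη]; field_simp
    linarith
  refine (ENNReal.ofReal_le_ofReal hfint).trans (ofReal_integral_le_lintegral hfi fun z => ?_)
  refine ENNReal.ofReal_le_ofReal ?_
  simp only [hf]
  set w : ℝ := (walk z.2 n : ℝ) with hw
  set x := position (targets z.1) z.2 t with hx
  have hs := Real.sq_sqrt (Nat.cast_nonneg (α := ℝ) n)
  have hs0 := Real.sqrt_nonneg (n : ℝ)
  have hηm : 0 ≤ η * m := by positivity
  by_cases hz : z ∈ A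
  · rw [Set.indicator_of_mem hz, ← hw]
    have : 0 ≤ η * m * (w ^ 2 + n) := by positivity
    nlinarith [sq_nonneg x]
  · rw [Set.indicator_of_notMem hz]
    have hxw : |x - m * w| ≤ η * √n := not_lt.mp hz
    have h1 : m ^ 2 * w ^ 2 - 2 * (|m * w| * |x - m * w|) ≤ x ^ 2 := by
      have h3 := neg_abs_le (m * w * (x - m * w))
      rw [abs_mul] at h3
      nlinarith [sq_nonneg (x - m * w)]
    have h2 : 2 * (|m * w| * |x - m * w|) ≤ η * m * (w ^ 2 + n) := by
      calc 2 * (|m * w| * |x - m * w|) ≤ 2 * (|m * w| * (η * √n)) := by gcongr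
        _ = η * m * (2 * |w| * √n) := by rw [abs_mul, abs_of_pos hm]; ring
        _ ≤ η * m * (w ^ 2 + n) := by
          gcongr
          nlinarith [sq_nonneg (|w| - √n), sq_abs w]
    linarith

end LevyEnv

open LevyEnv in
theorem mainTheorem4
    (ν : Measure ℝ) [IsProbabilityMeasure ν]
    (hν_pos : ∀ᵐ x ∂ν, 0 < x) (hν_int : Integrable (fun x : ℝ => x) ν)
    (p : PMF ℤ)
    (hp_symm : ∀ k : ℤ, p (-k) = p k)
    (hp_mono : ∀ k : ℤ, 1 ≤ k → p (k + 1) ≤ p k)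
    (hp_var : Summable fun k : ℤ => (k : ℝ) ^ 2 * (p k).toReal)
    (hp_var_pos : 0 < ∑' k : ℤ, (k : ℝ) ^ 2 * (p k).toReal) :
    Tendsto (LevyEnv.scaledMoment p 2) atTop (𝓝 (LevyEnv.limitMoment p 2)) ∧
    ENNReal.ofReal ((∫ x, x ∂ν) / LevyEnv.meanAbsJump p) * LevyEnv.limitMoment p 2 ≤
      liminf (fun t : ℝ≥0 =>
        (∫⁻ z, ENNReal.ofReal ((z.1 t) ^ 2) ∂(LevyEnv.annealedLaw ν p)) / (t : ℝ≥0∞)) atTop := by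
  have hL := memLp_jump hp_var
  have h1 := apply_one_ne_zero hp_symm hp_mono hp_var_pos
  have hlim := tendsto_scaledMoment_two hp_symm hL
  have heq : limitMoment p 2 = _ := hlim.limUnder_eq
  refine ⟨heq ▸ hlim, ?_⟩
  have hm := integral_gap_pos hν_pos hν_int
  have hmb := meanAbsJump_pos hL h1
  rw [heq]
  simp only [lintegral_annealedLaw]
  set m := ∫ x, x ∂ν with hmdef
  set v := ∫ k : ℤ, (k : ℝ) ^ 2 ∂p.toMeasure with hv
  have hv0 : 0 ≤ v := integral_nonneg fun k => sq_nonneg _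
  set κ := m * meanAbsJump p with hκ
  have hκ0 : 0 < κ := mul_pos hm hmb
  rw [← ENNReal.ofReal_mul (by positivity)]
  refine le_of_forall_lt fun c hc => ?_
  obtain ⟨c', hcc', hc'⟩ := exists_between hc
  refine hcc'.trans_le ?_
  have hc'top : c' ≠ ⊤ := (hc'.trans ENNReal.ofReal_lt_top).ne
  set a := c'.toReal with ha
  have ha0 : 0 ≤ a := ENNReal.toReal_nonneg
  have hav : a < m / meanAbsJump p * v := by
    rwa [← ENNReal.ofReal_toReal hc'top, ENNReal.ofReal_lt_ofReal_iff_of_nonneg ha0] at hc'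
  have haκ : a * κ < m ^ 2 * v := by
    calc a * κ < m / meanAbsJump p * v * κ := by gcongr
      _ = m ^ 2 * v := by rw [hκ]; field_simp
  set ρ := (m ^ 2 * v - a * κ) / 2 with hρ
  have hρ0 : 0 < ρ := by rw [hρ]; linarith
  obtain ⟨N, hN⟩ := exists_forall_le_lintegral_position hν_pos hν_int hp_symm hL h1 hρ0
  obtain ⟨N', hN'⟩ := exists_nat_ge (a * κ / ρ)
  refine le_liminf_of_le (by isBoundedDefault) ?_
  have hcoe : Tendsto (fun t : ℝ≥0 => ((t : ℝ) / κ)) atTop atTop :=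
    (NNReal.tendsto_coe_atTop.mpr tendsto_id).atTop_div_const hκ0
  filter_upwards [(tendsto_nat_floor_atTop.comp hcoe).eventually_ge_atTop (max N N'),
    eventually_gt_atTop 0] with t ht ht0
  set n := ⌊(t : ℝ) / κ⌋₊ with hn
  have ht' : max N N' ≤ n := ht
  have hn1 : κ * n ≤ t := by
    rw [mul_comm, ← le_div_iff₀ hκ0]
    exact Nat.floor_le (by positivity)
  have hn2 : (t : ℝ) < κ * (n + 1) := by
    rw [mul_comm, ← div_lt_iff₀ hκ0]
    exact Nat.lt_floor_add_one _
  have h := hN n ((le_max_left _ _).trans ht') t hn1 hn2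
  rw [ENNReal.le_div_iff_mul_le (Or.inl (by simpa using ht0.ne')) (Or.inl ENNReal.coe_ne_top)]
  refine le_trans ?_ h
  rw [← ENNReal.ofReal_toReal hc'top, ← ENNReal.ofReal_coe_nnreal, ← ENNReal.ofReal_mul ha0]
  refine ENNReal.ofReal_le_ofReal ?_
  have hnN : a * κ ≤ n * ρ := by
    rw [← div_le_iff₀ hρ0]
    exact hN'.trans (by exact_mod_cast (le_max_right _ _).trans ht')
  calc a * t ≤ a * (κ * (n + 1)) := by gcongr
    _ = n * (a * κ) + a * κ := by ring
    _ ≤ n * (a * κ) + n * ρ := by gcongr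
    _ = n * (m ^ 2 * v - ρ) := by rw [hρ]; ring
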